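/- Let $n\ge 1$, let $H^{(n)}=L^2(S^1,\mathbb C^n)$, and let $H^{(n)}_+$ (resp. $H^{(n)}_-$) be the closed span of the vectors $z^k e_\alpha$ with $k\ge 0$ (resp. $k<0$), $\alpha=1,\dots,n$. Let $W\in \mathrm{Gr}^{(n)}$, i.e. $W\subseteq H^{(n)}$ is a closed subspace with $zW\subseteq W$ for which the orthogonal projection $\mathrm{pr}_+:W\to H^{(n)}_+$ is Fredholm and $\mathrm{pr}_-:W\to H^{(n)}_-$ is Hilbert–Schmidt, and suppose that $W$ lies in the big cell, i.e. $\mathrm{pr}_+:W\to H^{(n)}_+$ is bijective. Call $w_1,\dots,w_n\in W$ a normalized frame if the matrix with columns $w_1,\dots,w_n$ is the sum of a constant upper triangular matrix with ones on the diagonal and a series in strictly negative powers of $z$. For a normalized frame put $\omega_{ns+j}(z)=z^{ns}\sum_{i=1}^n z^{i-1}(w_j)_i(z^n)$ ($s\ge 0$, $1\le j\le n$), let $t=(t_1,t_2,\dots)$, $\xi(t,z)=\sum_{i\ge1}t_iz^i$, $D=\partial/\partial t_1$, and define, as formal power series in $t$ and formal pseudo-differential operators over them, $$\tau_{W,N}=\det\Big[\tfrac1{2\pi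 i}\oint z^{-i}e^{\xi(t,z)}\omega_j(z)\,dz\Big]_{1\le i,j\le nN},\qquad f_{s,N}=\tfrac1{2\pi i}\oint z^{-nN}e^{\xi(t,z)}\omega_s(z)\,dz,$$ $$\Delta_{W,N}(f)=\frac{\mathrm{Wr}(f,f_{1,N},\dots,f_{nN,N})}{\mathrm{Wr}(f_{1,N},\dots,f_{nN,N})},\quad S_{W,N}=\Delta_{W,N}D^{-nN},\quad \psi_{W,N}=S_{W,N}e^{\xi(t,z)},\quad \mathcal L_{W,N}=S_{W,N}DS_{W,N}^{-1},$$ where $\mathrm{Wr}(g_1,\dots,g_M)=\det[D^{M-j}g_i]_{1\le i,j\le M}$. Give $t_m$ degree $m$; a stable limit of series is a limit in which, for every $Q$, all terms of degree at most $Q$ are eventually constant, and stable limits of operators and of wave functions are taken coefficientwise in $D^k$, resp. in $z^k$ after factoring out $e^{\xi(t,z)}$. Then normalized frames of $W$ exist, and for $N\to\infty$ the stable limits $\tau_W,S_W,\psi_W,\mathcal L_W,L_W$ of $\tau_{W,N}$, $S_{W,N}$, $\psi_{W,N}$, $\mathcal L_{W,N}$, $\mathcal L_{W,N}^n$ exist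 and do not depend on the normalized frame. Moreover $S_W=1+O(D^{-1})$ is invertible, $\psi_W=S_We^{\xi}$, $\mathcal L_W=S_WDS_W^{-1}$ solves the KP hierarchy $\partial\mathcal L_W/\partial t_j=[(\mathcal L_W^j)_+,\mathcal L_W]$ ($j\ge1$), $L_W=\mathcal L_W^n$, and $\tau_W,\psi_W,L_W$ are the $\tau$-function, the wave function and the differential operator of order $n$ of a solution of the $n$-th Gelfand–Dickey hierarchy: 1. $L_W=(L_W)_+=D^n+u_{n-2}D^{n-2}+\dots+u_0$, $\ \partial L_W/\partial t_j=[(L_W^{j/n})_+,L_W]$ for all $j\ge1$ with $L_W^{1/n}=\mathcal L_W$, and $L_W$ does not depend on the times $t_{nk}$, $k\ge1$; 2. $\psi_W=e^{\xi(t,z)}(1+O(z^{-1}))$, $\ L_W\psi_W=z^n\psi_W$, and $\partial\psi_W/\partial t_j=(\mathcal L_W^j)_+\psi_W$ for all $j\ge 1$; 3. $\tau_W$ has nonzero constant term and $\psi_W(t;z)=e^{\xi(t,z)}\,\tau_W\big(t_1-\tfrac1z,\,t_2-\tfrac1{2z^2},\,t_3-\tfrac1{3z^3},\dots\big)/\tau_W(t)$.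 -/

import Mathlib

namespace GelfandDickey

open MeasureTheory AddCircle

noncomputable section

/-! ### The Hilbert space `L²(S¹, ℂⁿ)` and its Grassmannian

The circle is `ℝ/ℤ`, with `z = exp (2πiθ)`, so that `z ^ k` is `fourier k`. -/

/-- `H n = L²(S¹, ℂⁿ)`. -/
abbrev H (n : ℕ) : Type :=
  Lp (EuclideanSpace ℂ (Fin n)) 2 (haarAddCircle : Measure UnitAddCircle)

/-- The basis vector `e_{α,k} = (0, …, z ^ k, …, 0)`. -/
def e (n : ℕ) (α : Fin n) (k : ℤ) : H n :=
  ContinuousMap.toLp 2 haarAddCircle ℂ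
    ⟨fun θ : UnitAddCircle => fourier k θ • EuclideanSpace.single α (1 : ℂ), by fun_prop⟩

/-- The closed subspace spanned by the `e_{α,k}` with `k ≥ 0`. -/
def Hplus (n : ℕ) : Submodule ℂ (H n) :=
  (Submodule.span ℂ {f | ∃ (α : Fin n) (k : ℤ), 0 ≤ k ∧ f = e n α k}).topologicalClosure

/-- The closed subspace spanned by the `e_{α,k}` with `k < 0`. -/
def Hminus (n : ℕ) : Submodule ℂ (H n) :=
  (Submodule.span ℂ {f | ∃ (α : Fin n) (k : ℤ), k < 0 ∧ f = e n α k}).topologicalClosure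

instance (n : ℕ) : CompleteSpace (Hplus n) :=
  inferInstanceAs (CompleteSpace (Submodule.topologicalClosure _))

instance (n : ℕ) : CompleteSpace (Hminus n) :=
  inferInstanceAs (CompleteSpace (Submodule.topologicalClosure _))

/-- The orthogonal projection `W → H₊`. -/
def prPlus {n : ℕ} (W : Submodule ℂ (H n)) : W →L[ℂ] Hplus n :=
  (Hplus n).orthogonalProjectionOnto ∘L W.subtypeL

/-- The orthogonal projection `W → H₋`. -/
def prMinus {n : ℕ} (W : Submodule ℂ (H n)) : W →L[ℂ] Hminus n :=
  (Hminus n).orthogonalProjectionOnto ∘L W.subtypeL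

/-- Hilbert–Schmidt operators: `∑ ‖T bᵢ‖² < ∞` for an orthonormal basis `b`. -/
def IsHilbertSchmidt {E F : Type*} [NormedAddCommGroup E] [InnerProductSpace ℂ E]
    [NormedAddCommGroup F] [InnerProductSpace ℂ F] (T : E →L[ℂ] F) : Prop :=
  ∃ (s : Set E) (b : HilbertBasis s ℂ E), Summable fun i => ‖T (b i)‖ ^ 2

/-- `Gr⁽ⁿ⁾`: closed subspaces `W` of `L²(S¹, ℂⁿ)` such that `pr₊ : W → H₊` is Fredholm,
`pr₋ : W → H₋` is Hilbert–Schmidt and `z W ⊆ W`. -/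
structure IsGr {n : ℕ} (W : Submodule ℂ (H n)) : Prop where
  isClosed : IsClosed (W : Set (H n))
  fredholm : (prPlus W).IsFredholm
  hilbertSchmidt : IsHilbertSchmidt (prMinus W)
  mul_z : ∀ f ∈ W, ∀ g : H n, (g =ᵐ[haarAddCircle] fun θ => fourier 1 θ • f θ) → g ∈ W

/-- The big cell: `pr₊ : W → H₊` is an isomorphism. -/
def InBigCell {n : ℕ} (W : Submodule ℂ (H n)) : Prop :=
  Function.Bijective (prPlus W)

/-- The columns `w₁, …, wₙ` of a normalized matrix `𝒲(z)` attached to `W`: they lie in `W`, and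
the matrix with these columns is a constant upper triangular matrix with ones on the diagonal
plus a series in strictly negative powers of `z`. -/
structure IsNormalizedFrame {n : ℕ} (W : Submodule ℂ (H n)) (w : Fin n → H n) : Prop where
  mem : ∀ j, w j ∈ W
  pos : ∀ j i, ∀ k : ℤ, 0 < k → fourierCoeff (w j : UnitAddCircle → _) k i = 0
  diag : ∀ j, fourierCoeff (w j : UnitAddCircle → _) 0 j = 1
  lower : ∀ j i, j < i → fourierCoeff (w j : UnitAddCircle → _) 0 i = 0

/-- `Ξ (f₀, …, f_{n-1}) (z) = f₀(zⁿ) + z f₁(zⁿ) + ⋯ + z ^ (n-1) f_{n-1}(zⁿ)`. -/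
def Xi {n : ℕ} (f : H n) (θ : UnitAddCircle) : ℂ :=
  ∑ i : Fin n, fourier (i : ℤ) θ * f (n • θ) i

/-- `omega w m` is `ω_{m+1}`, where `ω_{ns+j} = z ^ (ns) Ξ(w_j)` for `j = 1, …, n`. -/
def omega {n : ℕ} [NeZero n] (w : Fin n → H n) (m : ℕ) (θ : UnitAddCircle) : ℂ :=
  fourier ((n * (m / n) : ℕ) : ℤ) θ * Xi (w (Fin.ofNat n m)) θ

/-! ### Formal power series in the times -/

/-- Formal power series in the times `t₁, t₂, …`. -/
abbrev R : Type := MvPowerSeries ℕ+ ℂ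

/-- The degree of a monomial, `t_m` having degree `m`. -/
def wt (d : ℕ+ →₀ ℕ) : ℕ := d.sum fun i m => (i : ℕ) * m

/-- `∂/∂t_j`. -/
abbrev pd (j : ℕ+) (f : R) : R := MvPowerSeries.pderiv ℂ j f

/-- `D = ∂/∂t₁`. -/
abbrev D (f : R) : R := pd 1 f

/-- `F` is the limit of the sequence `f` of formal graded series: the degree of the lowest term
of `f N - F` tends to infinity. -/
def IsStableLimit (f : ℕ → R) (F : R) : Prop :=
  ∀ Q : ℕ, ∃ N₀ : ℕ, ∀ N ≥ N₀, ∀ d : ℕ+ →₀ ℕ, wt d ≤ Q →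
    MvPowerSeries.coeff d (f N) = MvPowerSeries.coeff d F

/-- The coefficient of `t ^ d` in `exp ξ(t,z)`, `ξ(t,z) = ∑ tᵢ zⁱ`: it is `z ^ (wt d) / ∏ dᵢ!`. -/
def expXiCoeff (d : ℕ+ →₀ ℕ) (θ : UnitAddCircle) : ℂ :=
  (d.prod fun _ m => ((m.factorial : ℂ))⁻¹) * fourier (wt d : ℤ) θ

/-- `(2πi)⁻¹ ∮ z ^ (-i) exp ξ(t,z) g(z) dz`, that is, the coefficient of `z ^ (i-1)` in
`exp ξ(t,z) g(z)`, as a formal series in `t`. -/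
def moment (i : ℕ) (g : UnitAddCircle → ℂ) : R :=
  fun d => fourierCoeff (fun θ => expXiCoeff d θ * g θ) ((i : ℤ) - 1)

/-- `τ_{W,N}(t) = det [∮ z ^ (-i) ω_j(t;z) dz]`, `1 ≤ i, j ≤ nN`. -/
def tauN {n : ℕ} [NeZero n] (w : Fin n → H n) (N : ℕ) : R :=
  (Matrix.of fun i j : Fin (n * N) => moment (i + 1) (omega w j)).det

/-- `Wr(f₁, …, f_M) = det [D ^ (M-j) fᵢ]`, `1 ≤ i, j ≤ M`. -/
def wronskian {M : ℕ} (f : Fin M → R) : R :=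
  (Matrix.of fun i j : Fin M => D^[M - 1 - j] (f i)).det

/-! ### Pseudo-differential operators -/

/-- Pseudo-differential operators `∑_{k ≤ K} a_k D ^ k` with coefficients in `R`. -/
@[ext]
structure PDO where
  coeff : ℤ → R
  bdd : ∃ K : ℤ, ∀ k > K, coeff k = 0

/-- The coefficients of `(∑ aᵢ Dⁱ)(∑ b_j D^j)`, where
`Dⁱ b = ∑_{l ≥ 0} (i choose l) D^l(b) D^(i-l)` for all integers `i`. -/
def leibniz (a b : ℤ → R) (m : ℤ) : R :=
  ∑ᶠ p : ℤ × ℕ, Ring.choose p.1 p.2 • (a p.1 * D^[p.2] (b (m - p.1 + p.2)))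

theorem leibniz_bdd {a b : ℤ → R} (ha : ∃ K : ℤ, ∀ k > K, a k = 0)
    (hb : ∃ K : ℤ, ∀ k > K, b k = 0) : ∃ K : ℤ, ∀ k > K, leibniz a b k = 0 := by
  obtain ⟨A, hA⟩ := ha
  obtain ⟨B, hB⟩ := hb
  have hD : ∀ l : ℕ, D^[l] (0 : R) = 0 := fun l =>
    Function.iterate_fixed (map_zero (MvPowerSeries.pderiv ℂ 1)) l
  refine ⟨A + B, fun k hk => ?_⟩
  unfold leibniz
  rw [← finsum_zero (α := ℤ × ℕ)]
  congr 1
  funext p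
  by_cases h : p.1 > A
  · simp [hA _ h]
  · rw [hB (k - p.1 + p.2) (by omega), hD]
    simp

namespace PDO

instance : Zero PDO := ⟨⟨fun _ => 0, 0, fun _ _ => rfl⟩⟩

/-- `D ^ k` for an integer `k`. -/
def Dpow (k : ℤ) : PDO := ⟨fun i => if i = k then 1 else 0, k, fun i hi => if_neg (by omega)⟩

instance : One PDO := ⟨Dpow 0⟩

instance : Sub PDO where
  sub a b := ⟨fun k => a.coeff k - b.coeff k, by
    obtain ⟨A, hA⟩ := a.bdd
    obtain ⟨B, hB⟩ := b.bdd
    exact ⟨max A B, fun k hk => by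
      rw [hA k (lt_of_le_of_lt (le_max_left _ _) hk),
        hB k (lt_of_le_of_lt (le_max_right _ _) hk), sub_zero]⟩⟩

/-- Composition. -/
instance : Mul PDO := ⟨fun a b => ⟨leibniz a.coeff b.coeff, leibniz_bdd a.bdd b.bdd⟩⟩

instance : Pow PDO ℕ := ⟨fun a k => npowRec k a⟩

open Classical in
/-- The two-sided inverse, if there is one. -/
instance : Inv PDO := ⟨fun a => if h : ∃ b : PDO, a * b = 1 ∧ b * a = 1 then h.choose else 0⟩

/-- The commutator. -/
def comm (a b : PDO) : PDO := a * b - b * a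

/-- The differential part `a₊`. -/
def plus (a : PDO) : PDO :=
  ⟨fun k => if 0 ≤ k then a.coeff k else 0, by
    obtain ⟨A, hA⟩ := a.bdd
    exact ⟨A, fun k hk => by rw [hA k hk, ite_self]⟩⟩

/-- `∂a/∂t_j`, coefficient by coefficient. -/
def tderiv (j : ℕ+) (a : PDO) : PDO :=
  ⟨fun k => pd j (a.coeff k), by
    obtain ⟨A, hA⟩ := a.bdd
    exact ⟨A, fun k hk => by rw [hA k hk]; exact map_zero _⟩⟩

/-- `a = D ^ m + (lower order terms)`. -/
def IsMonic (a : PDO) (m : ℤ) : Prop := a.coeff m = 1 ∧ ∀ k > m, a.coeff k = 0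

/-- Stable limit of every coefficient. -/
def IsStableLimit (a : ℕ → PDO) (A : PDO) : Prop :=
  ∀ k : ℤ, GelfandDickey.IsStableLimit (fun N => (a N).coeff k) (A.coeff k)

end PDO

/-! ### Formal wave functions -/

/-- Formal expressions `exp ξ(t,z) ∑_{k ≤ K} c_k(t) z ^ k`. -/
@[ext]
structure Wave where
  coeff : ℤ → R
  bdd : ∃ K : ℤ, ∀ k > K, coeff k = 0

namespace Wave

/-- `exp ξ(t,z)`. -/
def expXi : Wave := ⟨fun k => if k = 0 then 1 else 0, 0, fun _ hk => if_neg (by omega)⟩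

/-- The action of pseudo-differential operators, determined by
`Dⁱ (c exp ξ) = ∑_{l ≥ 0} (i choose l) D^l(c) z ^ (i-l) exp ξ`. -/
def act (a : PDO) (f : Wave) : Wave :=
  ⟨leibniz a.coeff f.coeff, leibniz_bdd a.bdd f.bdd⟩

/-- Multiplication by `z ^ m`. -/
def zmul (m : ℤ) (f : Wave) : Wave :=
  ⟨fun k => f.coeff (k - m), by
    obtain ⟨A, hA⟩ := f.bdd
    exact ⟨A + m, fun k hk => hA _ (by omega)⟩⟩

/-- `∂/∂t_j (exp ξ c z ^ k) = exp ξ (∂c/∂t_j z ^ k + c z ^ (k+j))`. -/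
def tderiv (j : ℕ+) (f : Wave) : Wave :=
  ⟨fun k => pd j (f.coeff k) + f.coeff (k - (j : ℕ)), by
    obtain ⟨A, hA⟩ := f.bdd
    refine ⟨A + (j : ℕ), fun k hk => ?_⟩
    rw [hA k (by have := j.pos; omega), hA (k - (j : ℕ)) (by omega), add_zero]
    exact map_zero _⟩

/-- Stable limit of every coefficient. -/
def IsStableLimit (f : ℕ → Wave) (F : Wave) : Prop :=
  ∀ k : ℤ, GelfandDickey.IsStableLimit (fun N => (f N).coeff k) (F.coeff k)

end Wave

/-- The coefficient of `z ^ (-m)` in `τ(t₁ - 1/z, t₂ - 1/(2z²), t₃ - 1/(3z³), …)`. -/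
def miwa (τ : R) (m : ℕ) : R :=
  fun d => ∑ᶠ (c : ℕ+ →₀ ℕ) (_ : wt c = m), MvPowerSeries.coeff (d + c) τ *
    c.prod fun i k => ((d i + k).choose k : ℂ) * (-1 / (i : ℂ)) ^ k

/-- `exp ξ(t,z) τ(t - [z⁻¹]) / τ(t)`. -/
def waveOfTau (τ : R) : Wave :=
  ⟨fun k => if k ≤ 0 then miwa τ (-k).toNat * τ⁻¹ else 0, 0, fun _ hk => if_neg (by omega)⟩

/-! ### The truncated objects attached to `W` -/

/-- `f_{s+1,N} = ∮ z ^ (-nN) ω_{s+1}(t;z) dz = ∑_k ω_{s+1}^{(-k)} p_{k+nN-1}(t)`, `p_m` being the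
Schur polynomials. -/
def fN {n : ℕ} [NeZero n] (w : Fin n → H n) (N : ℕ) (s : Fin (n * N)) : R :=
  moment (n * N) (omega w s)

/-- The differential operator `f ↦ Wr(f, f_{1,N}, …, f_{nN,N}) / Wr(f_{1,N}, …, f_{nN,N})`; the
coefficient of `D ^ k` is read off from the expansion of the numerator along its first row
`(D ^ (nN) f, …, D f, f)`. -/
def DeltaN {n : ℕ} [NeZero n] (w : Fin n → H n) (N : ℕ) : PDO :=
  ⟨fun k => (Matrix.of (Fin.cons (fun j : Fin (n * N + 1) => if k = (n * N : ℕ) - (j : ℤ) then 1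
      else 0) fun (i : Fin (n * N)) j => D^[n * N - j] (fN w N i))).det * (wronskian (fN w N))⁻¹, by
    refine ⟨(n * N : ℕ), fun k hk => ?_⟩
    rw [Matrix.det_eq_zero_of_row_eq_zero 0, zero_mul]
    intro j
    exact if_neg (by omega)⟩

/-- `S_{W,N} = Δ_{W,N} D ^ (-nN)`. -/
def SN {n : ℕ} [NeZero n] (w : Fin n → H n) (N : ℕ) : PDO :=
  DeltaN w N * PDO.Dpow (-(n * N : ℕ))

/-- `ψ_{W,N} = S_{W,N} exp ξ`. -/
def psiN {n : ℕ} [NeZero n] (w : Fin n → H n) (N : ℕ) : Wave :=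
  Wave.act (SN w N) Wave.expXi

/-- `𝓛_{W,N} = S_{W,N} D S_{W,N}⁻¹`. -/
def LaxN {n : ℕ} [NeZero n] (w : Fin n → H n) (N : ℕ) : PDO :=
  SN w N * PDO.Dpow 1 * (SN w N)⁻¹

/-! ### The hierarchies -/

/-- `𝓛 = D + O(D⁻¹)` solves the KP hierarchy `∂𝓛/∂t_j = [(𝓛 ^ j)₊, 𝓛]`. -/
structure IsKPSolution (𝓛 : PDO) : Prop where
  monic : 𝓛.IsMonic 1
  sub : 𝓛.coeff 0 = 0
  lax : ∀ j : ℕ+, 𝓛.tderiv j = PDO.comm (𝓛 ^ (j : ℕ)).plus 𝓛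

/-- `L = D ^ n + u_{n-2} D ^ (n-2) + ⋯ + u₀` is a differential operator of order `n` that, together
with its `n`-th root `𝓛`, solves the `n`-th Gelfand–Dickey hierarchy
`∂L/∂t_j = [(L ^ (j/n))₊, L]`. For `n ∣ j` the equation says that `L` does not depend on `t_j`. -/
structure IsGelfandDickeySolution (n : ℕ) (L 𝓛 : PDO) : Prop where
  monic : L.IsMonic n
  sub : L.coeff (n - 1) = 0
  differential : L = L.plus
  root_monic : 𝓛.IsMonic 1
  root : 𝓛 ^ n = L
  lax : ∀ j : ℕ+, L.tderiv j = PDO.comm (𝓛 ^ (j : ℕ)).plus L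
  stationary : ∀ j : ℕ+, n ∣ j → ∀ k, pd j (L.coeff k) = 0

/-- `ψ = exp ξ (1 + O(z⁻¹))` is a wave function of the solution `L`, with `n`-th root `𝓛`, of the
`n`-th Gelfand–Dickey hierarchy. -/
structure IsWaveFunction (n : ℕ) (L 𝓛 : PDO) (ψ : Wave) : Prop where
  leading : ψ.coeff 0 = 1
  pos : ∀ k > 0, ψ.coeff k = 0
  eigen : Wave.act L ψ = Wave.zmul n ψ
  evolution : ∀ j : ℕ+, ψ.tderiv j = Wave.act (𝓛 ^ (j : ℕ)).plus ψ

/-- `τ` is a `τ`-function for the wave function `ψ`. -/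
structure IsTauFunction (ψ : Wave) (τ : R) : Prop where
  ne_zero : MvPowerSeries.constantCoeff τ ≠ 0
  wave : ψ = waveOfTau τ

end

end GelfandDickey

open GelfandDickey

/-!
Write `ω_j = ∑ c_{j,l} z ^ l`. For a normalized frame `c_j = z ^ j + (lower powers)`, and `τ_{W,N}`
is the determinant of the coefficients of `exp ξ ω_j`.

* Adding to the last row the previous ones, weighted by the coefficients of `exp (-ξ)`, shows that
  the `M × M` and `(M + 1) × (M + 1)` determinants agree up to terms of degree greater than `M`. So
  `τ_{W,N}` stabilizes, and its constant term is `1`.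
* The shift `t ↦ t - [z⁻¹]` is a ring homomorphism sending the moment `g_a` to `g_a - z⁻¹ g_{a-1}`.
  After column operations the shifted determinant becomes the cofactor expansion of the numerator
  of `Δ_{W,N}`. Hence `S_{W,N}` has the symbol `τ_{W,N}(t - [z⁻¹]) / τ_{W,N}(t)`: it depends on
  `τ_{W,N}` only, and converges with it.
* The operators `∂Δ_{W,N}/∂t_j + Δ_{W,N} D ^ j` and `Δ_{W,N+1}` annihilate all `f_{s,N}`, so they
  are of the form `B Δ_{W,N}` with `B` a differential operator. This gives the Sato equations
  `∂S/∂t_j + S D ^ j = B_j S` for `S = S_{W,N}` as well as `S_{W,N+1} D ^ n = B S_{W,N}`. In the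
  limit, the former yield the KP hierarchy and the evolution of the wave function, and the latter
  says that `L = S D ^ n S⁻¹` is differential.
* In the big cell two normalized frames differ by a constant unitriangular matrix, so that they have
  the same `τ_{W,N}`.
-/

namespace GelfandDickey

open MeasureTheory AddCircle Filter

noncomputable section

/-! ### The ring of pseudo-differential operators -/

theorem pd_mul (j : ℕ+) (f g : R) : pd j (f * g) = pd j f * g + f * pd j g := by
  rw [pd, Derivation.leibniz, smul_eq_mul, smul_eq_mul]; ring

theorem pd_sum {ι : Type*} (j : ℕ+) (s : Finset ι) (f : ι → R) :
    pd j (∑ i ∈ s, f i) = ∑ i ∈ s, pd j (f i) := map_sum (MvPowerSeries.pderiv ℂ j) f s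

theorem pd_zsmul (j : ℕ+) (k : ℤ) (f : R) : pd j (k • f) = k • pd j f :=
  map_zsmul (MvPowerSeries.pderiv ℂ j) k f

theorem D_iterate_zero (l : ℕ) : D^[l] (0 : R) = 0 :=
  iterate_map_zero (MvPowerSeries.pderiv ℂ 1) l

theorem D_iterate_add (l : ℕ) (f g : R) : D^[l] (f + g) = D^[l] f + D^[l] g :=
  iterate_map_add (MvPowerSeries.pderiv ℂ 1) l f g

theorem D_iterate_one {l : ℕ} (hl : l ≠ 0) : D^[l] (1 : R) = 0 := by
  obtain ⟨l, rfl⟩ := Nat.exists_eq_succ_of_ne_zero hl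
  rw [Function.iterate_succ_apply, show D (1 : R) = 0 from MvPowerSeries.pderiv_one,
    D_iterate_zero]

theorem pd_comm (i j : ℕ+) (f : R) : pd i (pd j f) = pd j (pd i f) := by
  ext d
  simp only [MvPowerSeries.coeff_pderiv]
  rw [add_right_comm]
  by_cases h : i = j
  · rw [h]
  · simp only [Finsupp.coe_add, Pi.add_apply, Finsupp.single_eq_of_ne (Ne.symm h),
      Finsupp.single_eq_of_ne h, add_zero]
    exact mul_right_comm _ _ _

theorem pd_D_iterate (j : ℕ+) (l : ℕ) (f : R) : pd j (D^[l] f) = D^[l] (pd j f) :=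
  (Function.Commute.iterate_left (fun f => pd_comm 1 j f) l f).symm

section Symbols

/-- The symbol `∑ a_k D ^ k` has order at most `K`. -/
def OrderLE (a : ℤ → R) (K : ℤ) : Prop := ∀ k > K, a k = 0

variable {a b c : ℤ → R} {A B C K : ℤ}

theorem OrderLE.mono (ha : OrderLE a A) (h : A ≤ B) : OrderLE a B :=
  fun k hk => ha k (by omega)

theorem OrderLE.add (ha : OrderLE a K) (hb : OrderLE b K) : OrderLE (a + b) K :=
  fun k hk => by rw [Pi.add_apply, ha k hk, hb k hk, add_zero]

theorem OrderLE.neg (ha : OrderLE a K) : OrderLE (-a) K :=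
  fun k hk => by rw [Pi.neg_apply, ha k hk, neg_zero]

theorem OrderLE.shift (ha : OrderLE a K) : OrderLE (fun j => a (j - 1)) (K + 1) :=
  fun k hk => ha _ (by omega)

theorem OrderLE.deriv (ha : OrderLE a K) (j : ℕ+) :
    OrderLE (fun k => pd j (a k)) K :=
  fun k hk => by simp only [ha k hk]; exact map_zero _

/-- The coefficients of `Dⁱ ∘ (∑ b_k D ^ k)`, for `i` of either sign. -/
def Dcomp (i : ℤ) (b : ℤ → R) (m : ℤ) : R :=
  ∑ᶠ l : ℕ, Ring.choose i l • D^[l] (b (m - i + l))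

theorem Dcomp_eq_sum (hb : OrderLE b B) (i m : ℤ) {L : ℕ}
    (hL : B - m + i < L) :
    Dcomp i b m = ∑ l ∈ Finset.range L, Ring.choose i l • D^[l] (b (m - i + l)) := by
  refine finsum_eq_sum_of_support_subset _ fun l hl => ?_
  by_contra h
  simp only [Finset.coe_range, Set.mem_Iio, not_lt] at h
  exact hl (by dsimp only; rw [hb _ (by omega), D_iterate_zero, smul_zero])

theorem orderLE_Dcomp (hb : OrderLE b B) (i : ℤ) : OrderLE (Dcomp i b) (B + i) :=
  fun m hm => by rw [Dcomp_eq_sum hb i m (L := 0) (by simpa using by omega), Finset.sum_range_zero]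

theorem leibniz_eq_sum (ha : OrderLE a A) (hb : OrderLE b B) (m : ℤ)
    {lo hi : ℤ} (hlo : lo ≤ m - B) (hhi : A ≤ hi) :
    leibniz a b m = ∑ i ∈ Finset.Icc lo hi, a i * Dcomp i b m := by
  have sum_box : leibniz a b m = ∑ p ∈ Finset.Icc lo hi ×ˢ Finset.range (B - m + hi + 1).toNat,
      Ring.choose p.1 p.2 • (a p.1 * D^[p.2] (b (m - p.1 + p.2))) := by
    refine finsum_eq_sum_of_support_subset _ fun p hp => ?_
    by_contra h
    refine hp ?_
    dsimp only
    simp only [Finset.coe_product, Finset.coe_Icc, Finset.coe_range, Set.mem_prod, Set.mem_Icc,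
      Set.mem_Iio] at h
    by_cases h1 : p.1 > A
    · rw [ha _ h1, zero_mul, smul_zero]
    · rw [hb _ (by omega), D_iterate_zero, mul_zero, smul_zero]
  rw [sum_box, Finset.sum_product]
  refine Finset.sum_congr rfl fun i hi_mem => ?_
  rw [Finset.mem_Icc] at hi_mem
  rw [Dcomp_eq_sum hb i m (L := (B - m + hi + 1).toNat) (by omega), Finset.mul_sum]
  exact Finset.sum_congr rfl fun l _ => (mul_smul_comm _ _ _).symm

theorem OrderLE.leibniz (ha : OrderLE a A) (hb : OrderLE b B) :
    OrderLE (leibniz a b) (A + B) := fun m hm => by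
  rw [leibniz_eq_sum ha hb m le_rfl le_rfl, Finset.Icc_eq_empty (by omega), Finset.sum_empty]

/-- The coefficients of `D ∘ (∑ a_k D ^ k)`. -/
def Dleft (a : ℤ → R) (m : ℤ) : R := D (a m) + a (m - 1)

/-- The coefficients are recovered from the top down. -/
theorem Dleft_injective (ha : OrderLE a A) (hb : OrderLE b B) (h : Dleft a = Dleft b) :
    a = b := by
  have agree : ∀ k : ℕ, ∀ m, max A B + 1 - k ≤ m → a m = b m := by
    intro k
    induction k with
    | zero => intro m hm; rw [ha _ (by omega), hb _ (by omega)]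
    | succ k ih =>
      intro m hm
      have h1 := congrFun h (m + 1)
      simp only [Dleft, ih (m + 1) (by push_cast at hm; omega), add_sub_cancel_right] at h1
      exact add_left_cancel h1
  funext m
  exact agree (max A B + 1 - m).toNat m (by omega)

theorem Dcomp_succ (hb : OrderLE b B) (i : ℤ) :
    Dcomp (i + 1) b = Dleft (Dcomp i b) := by
  funext m
  set L := (B - m + i + 1).toNat
  rw [Dleft, Dcomp_eq_sum hb (i + 1) m (L := L + 1) (by omega), Dcomp_eq_sum hb i m (L := L)
    (by omega), Dcomp_eq_sum hb i (m - 1) (L := L + 1) (by omega), Finset.sum_range_succ',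
    Finset.sum_range_succ' _ L, D, pd_sum, ← add_assoc, ← Finset.sum_add_distrib]
  congr 1
  · refine Finset.sum_congr rfl fun l _ => ?_
    rw [Ring.choose_succ_succ, add_smul, pd_zsmul, Function.iterate_succ_apply',
      show m - (i + 1) + ((l + 1 : ℕ) : ℤ) = m - i + l by push_cast; ring,
      show m - 1 - i + ((l + 1 : ℕ) : ℤ) = m - i + l by push_cast; ring,
      Function.iterate_succ_apply']
  · simp only [Ring.choose_zero_right]
    congr 3
    ring

theorem Dcomp_zero (hb : OrderLE b B) : Dcomp 0 b = b := by
  funext m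
  rw [Dcomp_eq_sum hb 0 m (L := (B - m).toNat + 1) (by omega), Finset.sum_range_succ',
    Finset.sum_eq_zero]
  · simp
  · intro l _
    rw [Ring.choose_zero_succ, zero_smul]

theorem Dcomp_add (hb : OrderLE b K) (hc : OrderLE c K) (i : ℤ) :
    Dcomp i (b + c) = Dcomp i b + Dcomp i c := by
  funext m
  set L := (K - m + i + 1).toNat
  rw [Pi.add_apply, Dcomp_eq_sum hb i m (L := L) (by omega), Dcomp_eq_sum hc i m (L := L)
    (by omega), Dcomp_eq_sum (hb.add hc) i m (L := L) (by omega), ← Finset.sum_add_distrib]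
  refine Finset.sum_congr rfl fun l _ => ?_
  rw [Pi.add_apply, D_iterate_add, smul_add]

theorem pd_Dcomp (j : ℕ+) (hb : OrderLE b B) (i m : ℤ) :
    pd j (Dcomp i b m) = Dcomp i (fun k => pd j (b k)) m := by
  set L := (B - m + i + 1).toNat
  rw [Dcomp_eq_sum hb i m (L := L) (by omega), Dcomp_eq_sum (hb.deriv j) i m (L := L) (by omega),
    pd_sum]
  exact Finset.sum_congr rfl fun l _ => by rw [pd_zsmul, pd_D_iterate]

theorem Dcomp_leading (hb : OrderLE b B) (i : ℤ) : Dcomp i b (B + i) = b B := by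
  rw [Dcomp_eq_sum hb i _ (L := 1) (by push_cast; omega)]
  simp

theorem Dcomp_subleading (hb : OrderLE b B) (i : ℤ) :
    Dcomp i b (B + i - 1) = b (B - 1) + i • D (b B) := by
  rw [Dcomp_eq_sum hb i _ (L := 2) (by push_cast; omega), Finset.sum_range_succ,
    Finset.sum_range_one]
  simp only [Ring.choose_zero_right, Ring.choose_one_right, one_smul, Function.iterate_zero_apply,
    Function.iterate_one]
  rw [show B + i - 1 - i + ((0 : ℕ) : ℤ) = B - 1 by push_cast; ring,
    show B + i - 1 - i + ((1 : ℕ) : ℤ) = B by push_cast; ring]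

theorem leibniz_add (ha : OrderLE a A) (hb : OrderLE b K)
    (hc : OrderLE c K) : leibniz a (b + c) = leibniz a b + leibniz a c := by
  funext m
  rw [Pi.add_apply, leibniz_eq_sum ha hb m le_rfl le_rfl, leibniz_eq_sum ha hc m le_rfl le_rfl,
    leibniz_eq_sum ha (hb.add hc) m le_rfl le_rfl, ← Finset.sum_add_distrib]
  refine Finset.sum_congr rfl fun l _ => ?_
  rw [Dcomp_add hb hc, Pi.add_apply, mul_add]

theorem add_leibniz (ha : OrderLE a A) (hb : OrderLE b A)
    (hc : OrderLE c K) : leibniz (a + b) c = leibniz a c + leibniz b c := by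
  funext m
  rw [Pi.add_apply, leibniz_eq_sum ha hc m le_rfl le_rfl, leibniz_eq_sum hb hc m le_rfl le_rfl,
    leibniz_eq_sum (ha.add hb) hc m le_rfl le_rfl, ← Finset.sum_add_distrib]
  refine Finset.sum_congr rfl fun l _ => ?_
  rw [Pi.add_apply, add_mul]

theorem Dleft_leibniz (hb : OrderLE b B) (hc : OrderLE c C) :
    Dleft (leibniz b c) = leibniz (Dleft b) c := by
  have h1 : Dleft b = (fun k => D (b k)) + fun k => b (k - 1) := rfl
  rw [h1, add_leibniz ((hb.deriv 1).mono (by omega : B ≤ B + 1)) hb.shift hc]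
  funext m
  rw [Pi.add_apply, Dleft, leibniz_eq_sum hb hc m (lo := m - 1 - C) (by omega) le_rfl,
    leibniz_eq_sum hb hc (m - 1) le_rfl le_rfl, leibniz_eq_sum (hb.deriv 1) hc m
      (lo := m - 1 - C) (by omega) le_rfl, leibniz_eq_sum hb.shift hc m le_rfl le_rfl, D, pd_sum,
    show m - C = (m - 1 - C) + 1 by ring, ← Finset.map_add_right_Icc, Finset.sum_map,
    ← Finset.sum_add_distrib, ← Finset.sum_add_distrib]
  refine Finset.sum_congr rfl fun j _ => ?_
  simp only [addRightEmbedding_apply, add_sub_cancel_right]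
  rw [Dcomp_succ hc, Dleft, mul_add, pd_mul, add_assoc]

/-- Injectivity of `D ∘ ·` makes the descent to negative `i` possible. -/
theorem Dcomp_leibniz (hb : OrderLE b B) (hc : OrderLE c C) (i : ℤ) :
    Dcomp i (leibniz b c) = leibniz (Dcomp i b) c := by
  have hbc := hb.leibniz hc
  have iff_succ : ∀ i, (Dcomp (i + 1) (leibniz b c) = leibniz (Dcomp (i + 1) b) c) ↔
      Dcomp i (leibniz b c) = leibniz (Dcomp i b) c := by
    intro i
    rw [Dcomp_succ hbc, Dcomp_succ hb, ← Dleft_leibniz (orderLE_Dcomp hb i) hc]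
    exact ⟨fun h => Dleft_injective (orderLE_Dcomp hbc i) ((orderLE_Dcomp hb i).leibniz hc) h,
      fun h => by rw [h]⟩
  induction i with
  | zero => rw [Dcomp_zero hbc, Dcomp_zero hb]
  | succ i ih => exact (iff_succ _).2 ih
  | pred i ih => exact (iff_succ _).1 (by rwa [sub_add_cancel])

theorem leibniz_assoc (ha : OrderLE a A) (hb : OrderLE b B)
    (hc : OrderLE c C) : leibniz (leibniz a b) c = leibniz a (leibniz b c) := by
  funext m
  rw [leibniz_eq_sum (ha.leibniz hb) hc m le_rfl le_rfl,
    leibniz_eq_sum ha (hb.leibniz hc) m le_rfl le_rfl]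
  have h1 : ∀ q ∈ Finset.Icc (m - C) (A + B), leibniz a b q * Dcomp q c m =
      ∑ i ∈ Finset.Icc (m - (B + C)) A, a i * (Dcomp i b q * Dcomp q c m) := by
    intro q hq
    rw [Finset.mem_Icc] at hq
    rw [leibniz_eq_sum ha hb q (lo := m - (B + C)) (by omega) le_rfl, Finset.sum_mul]
    exact Finset.sum_congr rfl fun i _ => mul_assoc _ _ _
  rw [Finset.sum_congr rfl h1, Finset.sum_comm]
  refine Finset.sum_congr rfl fun i hi => ?_
  rw [Finset.mem_Icc] at hi
  rw [← Finset.mul_sum, Dcomp_leibniz hb hc, leibniz_eq_sum (orderLE_Dcomp hb i) hc m le_rfl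
    (hi := A + B) (by omega)]

end Symbols

namespace PDO

theorem exists_orderLE (a : PDO) : ∃ K, OrderLE a.coeff K := a.bdd

theorem exists_orderLE_pair (a b : PDO) : ∃ K, OrderLE a.coeff K ∧ OrderLE b.coeff K := by
  obtain ⟨A, hA⟩ := a.exists_orderLE
  obtain ⟨B, hB⟩ := b.exists_orderLE
  exact ⟨max A B, hA.mono (le_max_left _ _), hB.mono (le_max_right _ _)⟩

instance : Add PDO where
  add a b := ⟨a.coeff + b.coeff, by
    obtain ⟨K, ha, hb⟩ := exists_orderLE_pair a b
    exact ⟨K, ha.add hb⟩⟩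

instance : Neg PDO where
  neg a := ⟨-a.coeff, by
    obtain ⟨K, ha⟩ := a.exists_orderLE
    exact ⟨K, ha.neg⟩⟩

theorem coeff_add (a b : PDO) (k : ℤ) : (a + b).coeff k = a.coeff k + b.coeff k := rfl
theorem coeff_sub (a b : PDO) (k : ℤ) : (a - b).coeff k = a.coeff k - b.coeff k := rfl
theorem coeff_zero (k : ℤ) : (0 : PDO).coeff k = 0 := rfl
theorem coeff_mul (a b : PDO) : (a * b).coeff = leibniz a.coeff b.coeff := rfl
theorem coeff_Dpow (i k : ℤ) : (Dpow i).coeff k = if k = i then 1 else 0 := rfl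

theorem orderLE_Dpow (i : ℤ) : OrderLE (Dpow i).coeff i := fun k hk => if_neg (by omega)

theorem coeff_Dpow_mul (i : ℤ) (b : PDO) : (Dpow i * b).coeff = Dcomp i b.coeff := by
  obtain ⟨K, hb⟩ := b.exists_orderLE
  funext m
  rw [coeff_mul, leibniz_eq_sum (orderLE_Dpow i) hb m (lo := min (m - K) i) (min_le_left _ _)
    le_rfl, Finset.sum_eq_single_of_mem i (by simp)]
  · rw [coeff_Dpow, if_pos rfl, one_mul]
  · intro j _ hj
    rw [coeff_Dpow, if_neg hj, zero_mul]

theorem Dcomp_Dpow (i j m : ℤ) :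
    Dcomp i (Dpow j).coeff m = if m = i + j then 1 else 0 := by
  rw [Dcomp, finsum_eq_single _ 0]
  · rw [Ring.choose_zero_right, one_smul, Function.iterate_zero_apply, coeff_Dpow]
    congr 1
    exact propext ⟨by push_cast; omega, by push_cast; omega⟩
  · intro l hl
    rw [coeff_Dpow]
    split
    · rw [D_iterate_one hl, smul_zero]
    · rw [D_iterate_zero, smul_zero]

theorem coeff_mul_Dpow (a : PDO) (j m : ℤ) : (a * Dpow j).coeff m = a.coeff (m - j) := by
  obtain ⟨K, ha⟩ := a.exists_orderLE
  rw [coeff_mul, leibniz_eq_sum ha (orderLE_Dpow j) m le_rfl (le_max_left K (m - j)),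
    Finset.sum_eq_single_of_mem (m - j) (by simp)]
  · rw [Dcomp_Dpow, if_pos (by ring), mul_one]
  · intro i _ hi
    rw [Dcomp_Dpow, if_neg (by omega), mul_zero]

instance : Ring PDO where
  add_assoc a b c := PDO.ext (add_assoc a.coeff b.coeff c.coeff)
  zero_add a := PDO.ext (zero_add a.coeff)
  add_zero a := PDO.ext (add_zero a.coeff)
  add_comm a b := PDO.ext (add_comm a.coeff b.coeff)
  neg_add_cancel a := PDO.ext (neg_add_cancel a.coeff)
  sub_eq_add_neg a b := PDO.ext (sub_eq_add_neg a.coeff b.coeff)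
  nsmul := nsmulRec
  zsmul := zsmulRec
  mul_assoc a b c := PDO.ext <| by
    obtain ⟨A, ha⟩ := a.exists_orderLE
    obtain ⟨B, hb⟩ := b.exists_orderLE
    obtain ⟨C, hc⟩ := c.exists_orderLE
    exact leibniz_assoc ha hb hc
  one_mul a := PDO.ext <| by
    obtain ⟨A, ha⟩ := a.exists_orderLE
    exact (coeff_Dpow_mul 0 a).trans (Dcomp_zero ha)
  mul_one a := PDO.ext <| funext fun m => (coeff_mul_Dpow a 0 m).trans (by rw [sub_zero])
  zero_mul a := PDO.ext <| by
    obtain ⟨A, ha⟩ := a.exists_orderLE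
    funext m
    rw [coeff_mul, leibniz_eq_sum (a := coeff 0) (A := 0) (fun _ _ => rfl) ha m le_rfl le_rfl]
    exact Finset.sum_eq_zero fun i _ => zero_mul _
  mul_zero a := PDO.ext <| by
    obtain ⟨A, ha⟩ := a.exists_orderLE
    funext m
    rw [coeff_mul, leibniz_eq_sum (b := coeff 0) (B := m - A - 1) ha (fun _ _ => rfl) m le_rfl
      le_rfl, Finset.Icc_eq_empty (by omega)]
    rfl
  left_distrib a b c := PDO.ext <| by
    obtain ⟨A, ha⟩ := a.exists_orderLE
    obtain ⟨K, hb, hc⟩ := exists_orderLE_pair b c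
    exact leibniz_add ha hb hc
  right_distrib a b c := PDO.ext <| by
    obtain ⟨A, hc⟩ := c.exists_orderLE
    obtain ⟨K, ha, hb⟩ := exists_orderLE_pair a b
    exact add_leibniz ha hb hc

end PDO

section Order

variable {a b : PDO} {A B K : ℤ}

theorem OrderLE.mul (ha : OrderLE a.coeff A) (hb : OrderLE b.coeff B) :
    OrderLE (a * b).coeff (A + B) := ha.leibniz hb

theorem OrderLE.sub (ha : OrderLE a.coeff K) (hb : OrderLE b.coeff K) :
    OrderLE (a - b).coeff K := fun k hk => by rw [PDO.coeff_sub, ha k hk, hb k hk, sub_zero]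

theorem OrderLE.pow (ha : OrderLE a.coeff (-1)) (k : ℕ) : OrderLE (a ^ k).coeff (-k) := by
  induction k with
  | zero => exact PDO.orderLE_Dpow 0
  | succ k ih => rw [pow_succ]; exact (ih.mul ha).mono (by push_cast; omega)

namespace PDO

/-- The coefficient of `D ^ k` as an additive map. -/
def coeffHom (k : ℤ) : PDO →+ R where
  toFun a := a.coeff k
  map_zero' := rfl
  map_add' _ _ := rfl

theorem coeff_sum {ι : Type*} (s : Finset ι) (a : ι → PDO) (k : ℤ) :
    (∑ i ∈ s, a i).coeff k = ∑ i ∈ s, (a i).coeff k := map_sum (coeffHom k) a s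

theorem IsMonic.orderLE (ha : a.IsMonic A) : OrderLE a.coeff A := ha.2

theorem coeff_mul_leading (ha : OrderLE a.coeff A) (hb : OrderLE b.coeff B) :
    (a * b).coeff (A + B) = a.coeff A * b.coeff B := by
  rw [coeff_mul, leibniz_eq_sum ha hb _ (lo := A) (by omega) le_rfl, Finset.Icc_self,
    Finset.sum_singleton, add_comm A B, Dcomp_leading hb]

theorem coeff_mul_subleading (ha : OrderLE a.coeff A) (hb : OrderLE b.coeff B) :
    (a * b).coeff (A + B - 1) =
      a.coeff (A - 1) * b.coeff B + a.coeff A * (b.coeff (B - 1) + A • D (b.coeff B)) := by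
  have h : Finset.Icc (A - 1) A = {A - 1, A} := by
    ext x
    simp only [Finset.mem_Icc, Finset.mem_insert, Finset.mem_singleton]
    omega
  rw [coeff_mul, leibniz_eq_sum ha hb _ (lo := A - 1) (by omega) le_rfl, h,
    Finset.sum_pair (by omega), ← Dcomp_subleading hb A, ← Dcomp_leading hb (A - 1)]
  ring_nf

theorem IsMonic.mul (ha : a.IsMonic A) (hb : b.IsMonic B) :
    (a * b).IsMonic (A + B) :=
  ⟨by rw [coeff_mul_leading ha.2 hb.2, ha.1, hb.1, one_mul], ha.orderLE.mul hb.orderLE⟩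

theorem isMonic_Dpow (k : ℤ) : (Dpow k).IsMonic k := ⟨if_pos rfl, orderLE_Dpow k⟩

theorem isMonic_one : (1 : PDO).IsMonic 0 := isMonic_Dpow 0

theorem IsMonic.pow (ha : a.IsMonic A) (k : ℕ) : (a ^ k).IsMonic (k * A) := by
  induction k with
  | zero => simpa using isMonic_one
  | succ k ih => rw [pow_succ, Nat.cast_succ, add_mul, one_mul]; exact ih.mul ha

theorem Dpow_mul_Dpow (i j : ℤ) : Dpow i * Dpow j = Dpow (i + j) := by
  ext1
  funext m
  rw [coeff_mul_Dpow, coeff_Dpow, coeff_Dpow]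
  congr 1
  exact propext ⟨fun h => by omega, fun h => by omega⟩

theorem Dpow_zero : Dpow 0 = 1 := rfl

/-- The Neumann series `∑ c ^ k` of an operator `c` of negative order. Only the terms with
`k ≤ -m` contribute to the coefficient of `D ^ m`, so that the sum can be truncated there. -/
def neumann (c : PDO) : PDO :=
  ⟨fun m => if m ≤ 0 then ∑ k ∈ Finset.range ((-m).toNat + 1), (c ^ k).coeff m else 0, 0,
    fun _ hm => if_neg (by omega)⟩

theorem isMonic_neumann (c : PDO) : (neumann c).IsMonic 0 := by
  refine ⟨?_, fun m hm => if_neg (by omega)⟩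
  change (if (0 : ℤ) ≤ 0 then ∑ k ∈ Finset.range ((-0 : ℤ).toNat + 1), (c ^ k).coeff 0 else 0) = 1
  rw [if_pos le_rfl, neg_zero, Int.toNat_zero, zero_add, Finset.sum_range_one, pow_zero,
    isMonic_one.1]

theorem orderLE_neumann_sub_geom_sum {c : PDO} (hc : OrderLE c.coeff (-1)) (K : ℕ) :
    OrderLE (neumann c - ∑ k ∈ Finset.range (K + 1), c ^ k).coeff (-K - 1) := by
  intro m hm
  rw [coeff_sub, coeff_sum, sub_eq_zero]
  have vanish : ∀ k : ℕ, -m < k → (c ^ k).coeff m = 0 := fun k hk => hc.pow k m (by omega)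
  change (if m ≤ 0 then ∑ k ∈ Finset.range ((-m).toNat + 1), (c ^ k).coeff m else 0) = _
  split_ifs with hm0
  · refine Finset.sum_subset (Finset.range_mono (by omega)) fun k _ hk => vanish k ?_
    rw [Finset.mem_range] at hk
    omega
  · exact (Finset.sum_eq_zero fun k _ => vanish k (by omega)).symm

theorem one_sub_mul_neumann {c : PDO} (hc : OrderLE c.coeff (-1)) : (1 - c) * neumann c = 1 := by
  ext1
  funext m
  set K := (-m).toNat
  set tail := neumann c - ∑ k ∈ Finset.range (K + 1), c ^ k
  have split : (1 - c) * neumann c = 1 - c ^ (K + 1) + (1 - c) * tail := by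
    rw [← mul_neg_geom_sum, mul_sub, add_sub_cancel]
  have h1c : OrderLE (1 - c).coeff 0 := isMonic_one.orderLE.sub (hc.mono (by omega))
  rw [split, coeff_add, coeff_sub,
    h1c.mul (orderLE_neumann_sub_geom_sum hc K) m (by omega), hc.pow (K + 1) m (by omega),
    sub_zero, add_zero]

theorem IsMonic.exists_right_inv (ha : a.IsMonic 0) : ∃ b : PDO, b.IsMonic 0 ∧ a * b = 1 := by
  have hc : OrderLE (1 - a).coeff (-1) := by
    intro k hk
    rcases eq_or_lt_of_le (show 0 ≤ k by omega) with rfl | hk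
    · rw [coeff_sub, ha.1, isMonic_one.1, sub_self]
    · rw [coeff_sub, ha.2 k hk, isMonic_one.2 k hk, sub_self]
  exact ⟨neumann (1 - a), isMonic_neumann _, by
    simpa only [sub_sub_cancel] using one_sub_mul_neumann hc⟩

theorem inv_eq_of_mul_eq_one (h1 : a * b = 1) (h2 : b * a = 1) : a⁻¹ = b := by
  have h : ∃ b : PDO, a * b = 1 ∧ b * a = 1 := ⟨b, h1, h2⟩
  have h3 : a⁻¹ = h.choose := dif_pos h
  rw [h3]
  exact left_inv_eq_right_inv h.choose_spec.2 h1

theorem IsMonic.inv_spec (ha : a.IsMonic 0) :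
    a⁻¹.IsMonic 0 ∧ a * a⁻¹ = 1 ∧ a⁻¹ * a = 1 := by
  obtain ⟨b, hb, hab⟩ := ha.exists_right_inv
  obtain ⟨c, -, hbc⟩ := hb.exists_right_inv
  have hba : b * a = 1 := by rwa [← left_inv_eq_right_inv hab hbc] at hbc
  rw [inv_eq_of_mul_eq_one hab hba]
  exact ⟨hb, hab, hba⟩

theorem IsMonic.mul_inv_cancel (ha : a.IsMonic 0) : a * a⁻¹ = 1 := ha.inv_spec.2.1
theorem IsMonic.inv_mul_cancel (ha : a.IsMonic 0) : a⁻¹ * a = 1 := ha.inv_spec.2.2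
theorem IsMonic.inv (ha : a.IsMonic 0) : a⁻¹.IsMonic 0 := ha.inv_spec.1

theorem coeff_tderiv (j : ℕ+) (a : PDO) (k : ℤ) : (a.tderiv j).coeff k = pd j (a.coeff k) := rfl

theorem tderiv_mul (j : ℕ+) (a b : PDO) :
    (a * b).tderiv j = a.tderiv j * b + a * b.tderiv j := by
  obtain ⟨A, ha⟩ := a.exists_orderLE
  obtain ⟨B, hb⟩ := b.exists_orderLE
  ext1
  funext m
  rw [coeff_tderiv, coeff_add, coeff_mul, coeff_mul, coeff_mul,
    leibniz_eq_sum ha hb m le_rfl le_rfl,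
    leibniz_eq_sum (a := (a.tderiv j).coeff) (ha.deriv j) hb m le_rfl le_rfl,
    leibniz_eq_sum (b := (b.tderiv j).coeff) ha (hb.deriv j) m le_rfl le_rfl, pd_sum,
    ← Finset.sum_add_distrib]
  refine Finset.sum_congr rfl fun i _ => ?_
  rw [pd_mul, pd_Dcomp j hb]
  rfl

theorem tderiv_Dpow (j : ℕ+) (k : ℤ) : (Dpow k).tderiv j = 0 := by
  ext1
  funext m
  rw [coeff_tderiv, coeff_Dpow, coeff_zero]
  split
  · exact MvPowerSeries.pderiv_one
  · exact map_zero _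

theorem tderiv_one (j : ℕ+) : (1 : PDO).tderiv j = 0 := tderiv_Dpow j 0

theorem tderiv_pow_eq_comm {j : ℕ+} (h : a.tderiv j = comm b a) (k : ℕ) :
    (a ^ k).tderiv j = comm b (a ^ k) := by
  induction k with
  | zero => rw [pow_zero, tderiv_one, comm, mul_one, one_mul, sub_self]
  | succ k ih =>
    rw [pow_succ, tderiv_mul, ih, h]
    simp only [comm]
    noncomm_ring

theorem IsMonic.orderLE_tderiv {k : ℤ} (ha : a.IsMonic k) (j : ℕ+) :
    OrderLE (a.tderiv j).coeff (k - 1) := by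
  intro m hm
  rw [coeff_tderiv]
  rcases eq_or_lt_of_le (show k ≤ m by omega) with rfl | h
  · rw [ha.1]; exact MvPowerSeries.pderiv_one
  · rw [ha.2 m h]; exact map_zero _

end PDO

end Order

namespace PDO

/-- Differential operators: no negative powers of `D`. -/
def IsDiff (a : PDO) : Prop := ∀ k < 0, a.coeff k = 0

theorem isDiff_plus (a : PDO) : a.plus.IsDiff := fun _ hk => if_neg (by omega)

theorem IsDiff.plus_eq {a : PDO} (ha : a.IsDiff) : a.plus = a := by
  ext1
  funext k
  change (if 0 ≤ k then a.coeff k else 0) = a.coeff k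
  split
  · rfl
  · rw [ha k (by omega)]

theorem orderLE_sub_plus (a : PDO) : OrderLE (a - a.plus).coeff (-1) := fun k hk => by
  rw [coeff_sub, sub_eq_zero]
  exact (if_pos (by omega)).symm

theorem plus_eq_of_orderLE_sub {a b : PDO} (hb : b.IsDiff) (h : OrderLE (a - b).coeff (-1)) :
    a.plus = b := by
  ext1
  funext k
  change (if 0 ≤ k then a.coeff k else 0) = b.coeff k
  split
  · exact sub_eq_zero.1 (h k (by omega))
  · rw [hb k (by omega)]

theorem IsDiff.sub {a b : PDO} (ha : a.IsDiff) (hb : b.IsDiff) : (a - b).IsDiff :=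
  fun k hk => by rw [coeff_sub, ha k hk, hb k hk, sub_zero]

theorem IsDiff.add {a b : PDO} (ha : a.IsDiff) (hb : b.IsDiff) : (a + b).IsDiff :=
  fun k hk => by rw [coeff_add, ha k hk, hb k hk, add_zero]

theorem IsDiff.tderiv {a : PDO} (ha : a.IsDiff) (j : ℕ+) : (a.tderiv j).IsDiff :=
  fun k hk => by rw [coeff_tderiv, ha k hk]; exact map_zero _

theorem isDiff_Dpow (k : ℕ) : (Dpow k).IsDiff := fun m hm => if_neg (by omega)

theorem IsDiff.mul {a b : PDO} (ha : a.IsDiff) (hb : b.IsDiff) : (a * b).IsDiff := by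
  intro m hm
  obtain ⟨A, hA⟩ := a.exists_orderLE
  obtain ⟨B, hB⟩ := b.exists_orderLE
  rw [coeff_mul, leibniz_eq_sum hA hB m le_rfl le_rfl]
  refine Finset.sum_eq_zero fun i _ => ?_
  rcases lt_or_ge i 0 with hi | hi
  · rw [ha i hi, zero_mul]
  · lift i to ℕ using hi
    rw [Dcomp, finsum_eq_zero_of_forall_eq_zero, mul_zero]
    intro l
    rcases lt_or_ge i l with hl | hl
    · rw [Ring.choose_natCast, Nat.choose_eq_zero_of_lt hl, Nat.cast_zero, zero_smul]
    · rw [hb _ (by omega), D_iterate_zero, smul_zero]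

theorem IsDiff.pow {a : PDO} (ha : a.IsDiff) (k : ℕ) : (a ^ k).IsDiff := by
  induction k with
  | zero => exact isDiff_Dpow 0
  | succ k ih => rw [pow_succ]; exact ih.mul ha

/-- The operator of multiplication by `f`. -/
def const (f : R) : PDO := ⟨fun k => if k = 0 then f else 0, 0, fun _ hk => if_neg (by omega)⟩

theorem coeff_const (f : R) (k : ℤ) : (const f).coeff k = if k = 0 then f else 0 := rfl

theorem orderLE_const (f : R) : OrderLE (const f).coeff 0 := fun _ hk => if_neg (by omega)

theorem isDiff_const (f : R) : (const f).IsDiff := fun _ hk => if_neg (by omega)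

theorem tderiv_const (j : ℕ+) (f : R) : (const f).tderiv j = const (pd j f) := by
  ext1
  funext k
  rw [coeff_tderiv, coeff_const, coeff_const]
  split
  · rfl
  · exact map_zero _

/-- The action of differential operators on functions. -/
def app (a : PDO) (f : R) : R := (a * const f).coeff 0

theorem app_mul {a b : PDO} (ha : a.IsDiff) (hb : b.IsDiff) (f : R) :
    app (a * b) f = app a (app b f) := by
  -- `b f = app b f + X D` with `X` differential, and `a X D` has no constant term.
  set X := (b * const f - const (app b f)) * Dpow (-1)
  have hX : X.IsDiff := by
    intro k hk
    rw [coeff_mul_Dpow, coeff_sub]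
    rcases eq_or_lt_of_le (show k - -1 ≤ 0 by omega) with h | h
    · rw [h, coeff_const, if_pos rfl]; exact sub_self _
    · rw [hb.mul (isDiff_const f) _ h, isDiff_const _ _ h, sub_zero]
  have decomposition : a * b * const f = a * const (app b f) + a * X * Dpow 1 := by
    simp only [X]
    rw [mul_assoc, mul_assoc, mul_assoc, Dpow_mul_Dpow, neg_add_cancel, Dpow_zero, mul_one,
      mul_sub]
    abel
  rw [app, decomposition, coeff_add, coeff_mul_Dpow, ha.mul hX _ (by norm_num), add_zero]
  rfl

theorem app_add (a b : PDO) (f : R) : app (a + b) f = app a f + app b f := by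
  rw [app, add_mul, coeff_add]
  rfl

theorem pd_app (j : ℕ+) (a : PDO) (f : R) :
    pd j (app a f) = app (a.tderiv j) f + app a (pd j f) := by
  rw [app, ← coeff_tderiv, tderiv_mul, tderiv_const, coeff_add]
  rfl

theorem const_zero : const 0 = 0 := by
  ext1
  funext k
  exact ite_self _

theorem app_zero (a : PDO) : app a 0 = 0 := by
  rw [app, const_zero, mul_zero]
  rfl

theorem app_eq_sum {a : PDO} {M : ℕ} (hM : OrderLE a.coeff (M - 1)) (f : R) :
    app a f = ∑ k ∈ Finset.range M, a.coeff k * D^[k] f := by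
  rw [app, coeff_mul, leibniz_eq_sum hM (orderLE_const f) 0 (lo := 0) (by rw [sub_zero]) le_rfl]
  symm
  refine Finset.sum_of_injOn (fun k : ℕ => (k : ℤ)) Nat.cast_injective.injOn ?_ ?_ ?_
  · intro k hk
    simp only [Finset.coe_range, Set.mem_Iio, Finset.coe_Icc, Set.mem_Icc] at hk ⊢
    omega
  · intro i hi not_mem_image
    rw [Finset.mem_Icc] at hi
    exact absurd ⟨i.toNat, by rw [Finset.coe_range, Set.mem_Iio]; omega, Int.toNat_of_nonneg hi.1⟩
      not_mem_image
  · intro k _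
    rw [Dcomp, finsum_eq_single _ k]
    · rw [Ring.choose_natCast, Nat.choose_self, Nat.cast_one, one_smul, coeff_const,
        if_pos (by ring)]
    · intro l hl
      rw [coeff_const, if_neg (by omega), D_iterate_zero, smul_zero]

theorem app_Dpow (k : ℕ) (f : R) : app (Dpow k) f = D^[k] f := by
  rw [app_eq_sum (M := k + 1) ((orderLE_Dpow k).mono (by push_cast; omega)),
    Finset.sum_eq_single_of_mem k (Finset.self_mem_range_succ k)]
  · rw [coeff_Dpow, if_pos rfl, one_mul]
  · intro l _ hl
    rw [coeff_Dpow, if_neg (by exact_mod_cast hl), zero_mul]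

theorem IsDiff.exists_eq_mul_add {P Δ : PDO} {M : ℤ} (hP : P.IsDiff) (hΔ : Δ.IsDiff)
    (hm : Δ.IsMonic M) :
    ∃ B T : PDO, B.IsDiff ∧ T.IsDiff ∧ OrderLE T.coeff (M - 1) ∧ P = B * Δ + T := by
  obtain ⟨Q, rfl⟩ : ∃ Q, P = Q * Δ := by
    have hS : (Δ * Dpow (-M)).IsMonic 0 := by
      simpa only [add_neg_cancel] using hm.mul (isMonic_Dpow (-M))
    set S := Δ * Dpow (-M) with hSdef
    refine ⟨P * (Dpow (-M) * S⁻¹), ?_⟩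
    have hΔS : Δ = S * Dpow M := by
      rw [hSdef, mul_assoc, Dpow_mul_Dpow, neg_add_cancel, Dpow_zero, mul_one]
    rw [hΔS, mul_assoc, mul_assoc, ← mul_assoc S⁻¹, hS.inv_mul_cancel, one_mul, Dpow_mul_Dpow,
      neg_add_cancel, Dpow_zero, mul_one]
  refine ⟨Q.plus, (Q - Q.plus) * Δ, isDiff_plus Q, ?_, ?_, ?_⟩
  · rw [sub_mul]
    exact hP.sub ((isDiff_plus Q).mul hΔ)
  · exact ((orderLE_sub_plus Q).mul hm.orderLE).mono (by omega)
  · rw [sub_mul, add_sub_cancel]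

theorem eq_zero_of_app_eq_zero {T : PDO} {M : ℕ} (hT : T.IsDiff) (hM : OrderLE T.coeff (M - 1))
    {f : Fin M → R} (hf : wronskian f ≠ 0) (hTf : ∀ s, app T (f s) = 0) : T = 0 := by
  have coeff_vec : (fun j : Fin M => T.coeff ((M - 1 - j : ℕ) : ℤ)) = 0 := by
    refine Matrix.eq_zero_of_mulVec_eq_zero hf ?_
    funext s
    have h := hTf s
    rw [app_eq_sum hM, ← Finset.sum_range_reflect, Finset.sum_range] at h
    rw [Pi.zero_apply, ← h]
    simp only [Matrix.mulVec, dotProduct, Matrix.of_apply, mul_comm]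
  ext1
  funext k
  rcases lt_or_ge k 0 with hk | hk
  · exact hT k hk
  rcases lt_or_ge ((M : ℤ) - 1) k with hkM | hkM
  · exact hM k hkM
  have h := congrFun coeff_vec ⟨M - 1 - k.toNat, by omega⟩
  rwa [show ((M - 1 - (M - 1 - k.toNat) : ℕ) : ℤ) = k by omega] at h

theorem exists_eq_mul_of_app_eq_zero {Δ P : PDO} {M : ℕ} (hΔ : Δ.IsDiff) (hm : Δ.IsMonic M)
    {f : Fin M → R} (hf : wronskian f ≠ 0) (hΔf : ∀ s, app Δ (f s) = 0) (hP : P.IsDiff)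
    (hPf : ∀ s, app P (f s) = 0) : ∃ B : PDO, B.IsDiff ∧ P = B * Δ := by
  obtain ⟨B, T, hB, hT, hTM, rfl⟩ := hP.exists_eq_mul_add hΔ hm
  refine ⟨B, hB, ?_⟩
  have hTf : ∀ s, app T (f s) = 0 := fun s => by
    rw [← hPf s, app_add, app_mul hB hΔ, hΔf, app_zero, zero_add]
  rw [eq_zero_of_app_eq_zero hT hTM hf hTf, add_zero]

end PDO

/-! ### Dressing operators -/

namespace PDO

/-- Dressing operators: monic operators of order zero that satisfy, for every time `t_j`, the
Sato equation `∂S/∂t_j + S D ^ j = B_j S` with some differential operator `B_j`. -/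
structure IsDressing (S : PDO) : Prop where
  monic : S.IsMonic 0
  sato : ∀ j : ℕ+, ∃ B : PDO, B.IsDiff ∧ S.tderiv j + S * Dpow (j : ℕ) = B * S

/-- The operator `𝓛 = S D S⁻¹` obtained from `D` by dressing with `S`. -/
def lax (S : PDO) : PDO := S * Dpow 1 * S⁻¹

section Monic

variable {S : PDO}

theorem IsMonic.lax_mul (hS : S.IsMonic 0) : lax S * S = S * Dpow 1 := by
  rw [lax, mul_assoc, hS.inv_mul_cancel, mul_one]

theorem IsMonic.lax_pow_mul (hS : S.IsMonic 0) (k : ℕ) : lax S ^ k * S = S * Dpow k := by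
  induction k with
  | zero => rw [pow_zero, one_mul, Nat.cast_zero, Dpow_zero, mul_one]
  | succ k ih =>
    rw [pow_succ, mul_assoc, hS.lax_mul, ← mul_assoc, ih, mul_assoc, Dpow_mul_Dpow, Nat.cast_succ]

theorem IsMonic.lax_pow (hS : S.IsMonic 0) (k : ℕ) : lax S ^ k = S * Dpow k * S⁻¹ := by
  rw [← hS.lax_pow_mul, mul_assoc _ S, hS.mul_inv_cancel, mul_one]

theorem IsMonic.isMonic_lax (hS : S.IsMonic 0) : (lax S).IsMonic 1 := by
  simpa only [lax, zero_add, add_zero] using (hS.mul (isMonic_Dpow 1)).mul hS.inv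

/-- Compare the subleading coefficients of `L S` and `S D ^ k`. -/
theorem coeff_sub_one_eq_zero_of_mul_eq {L : PDO} {k : ℤ} (hS : S.IsMonic 0) (hL : L.IsMonic k)
    (h : L * S = S * Dpow k) : L.coeff (k - 1) = 0 := by
  have subleading := coeff_mul_subleading hL.orderLE hS.orderLE
  rw [h, coeff_mul_Dpow, hS.1, hL.1, show D (1 : R) = 0 from MvPowerSeries.pderiv_one, smul_zero,
    add_zero, add_zero, mul_one, one_mul, show k - 1 - k = 0 - 1 by ring] at subleading
  exact right_eq_add.1 subleading

end Monic

namespace IsDressing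

variable {S : PDO}

/-- `B S = 𝓛 ^ j S + ∂S/∂t_j`, whose last term has negative order, so that `B = (𝓛 ^ j)₊`. -/
theorem tderiv_add_mul_Dpow (hS : S.IsDressing) (j : ℕ+) :
    S.tderiv j + S * Dpow (j : ℕ) = (lax S ^ (j : ℕ)).plus * S := by
  obtain ⟨B, hB, hBS⟩ := hS.sato j
  suffices h : (lax S ^ (j : ℕ)).plus = B by rw [h, hBS]
  refine plus_eq_of_orderLE_sub hB ?_
  have hdiff : lax S ^ (j : ℕ) - B = -(S.tderiv j * S⁻¹) := by
    rw [← mul_one B, ← hS.monic.mul_inv_cancel, ← mul_assoc, ← hBS, add_mul, hS.monic.lax_pow,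
      sub_add_cancel_right]
  rw [hdiff]
  exact (((hS.monic.orderLE_tderiv j).mul hS.monic.inv.orderLE).mono (by omega)).neg

theorem tderiv_lax (hS : S.IsDressing) (j : ℕ+) :
    (lax S).tderiv j = comm (lax S ^ (j : ℕ)).plus (lax S) := by
  have hLS := hS.monic.lax_mul
  set L := lax S
  set B := (L ^ (j : ℕ)).plus
  have hsato : S.tderiv j = B * S - S * Dpow (j : ℕ) :=
    eq_sub_of_add_eq (hS.tderiv_add_mul_Dpow j)
  have product_rule : L.tderiv j * S + L * S.tderiv j = S.tderiv j * Dpow 1 := by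
    rw [← tderiv_mul, hLS, tderiv_mul, tderiv_Dpow, mul_zero, add_zero]
  have hLSD : L * (S * Dpow (j : ℕ)) = S * Dpow (j : ℕ) * Dpow 1 := by
    rw [← mul_assoc, hLS, mul_assoc, mul_assoc, Dpow_mul_Dpow, Dpow_mul_Dpow, add_comm]
  have lax_mul_S : L.tderiv j * S = comm B L * S := by
    rw [eq_sub_of_add_eq product_rule, hsato, sub_mul, mul_sub, hLSD, comm, sub_mul, mul_assoc B S,
      ← hLS, mul_assoc B L, mul_assoc L B]
    abel
  simpa only [mul_assoc, hS.monic.mul_inv_cancel, mul_one] using congrArg (· * S⁻¹) lax_mul_S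

theorem isKPSolution (hS : S.IsDressing) : IsKPSolution (lax S) where
  monic := hS.monic.isMonic_lax
  sub := coeff_sub_one_eq_zero_of_mul_eq hS.monic hS.monic.isMonic_lax hS.monic.lax_mul
  lax := hS.tderiv_lax

theorem isGelfandDickeySolution (hS : S.IsDressing) {n : ℕ} (hn : (lax S ^ n).IsDiff) :
    IsGelfandDickeySolution n (lax S ^ n) (lax S) := by
  have hmonic : (lax S ^ n).IsMonic n := by simpa only [mul_one] using hS.monic.isMonic_lax.pow n
  have hlax : ∀ j : ℕ+, (lax S ^ n).tderiv j = comm (lax S ^ (j : ℕ)).plus (lax S ^ n) :=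
    fun j => tderiv_pow_eq_comm (hS.tderiv_lax j) n
  have hstationary : ∀ j : ℕ+, n ∣ j → (lax S ^ n).tderiv j = 0 := by
    rintro j ⟨q, hq⟩
    rw [hlax, hq, pow_mul, (hn.pow q).plus_eq, comm, ← pow_succ, ← pow_succ', sub_self]
  exact ⟨hmonic, coeff_sub_one_eq_zero_of_mul_eq hS.monic hmonic (hS.monic.lax_pow_mul n),
    hn.plus_eq.symm, hS.monic.isMonic_lax, rfl, hlax,
    fun j hj => congrFun (congrArg PDO.coeff (hstationary j hj))⟩

end IsDressing

end PDO

theorem coeff_act_expXi (S : PDO) : (Wave.act S Wave.expXi).coeff = S.coeff := by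
  change (S * 1).coeff = S.coeff
  rw [mul_one]

theorem act_act_expXi (a S : PDO) :
    Wave.act a (Wave.act S Wave.expXi) = Wave.act (a * S) Wave.expXi := by
  ext1
  rw [coeff_act_expXi, PDO.coeff_mul, ← coeff_act_expXi S]
  rfl

theorem zmul_act_expXi (S : PDO) (m : ℤ) :
    Wave.zmul m (Wave.act S Wave.expXi) = Wave.act (S * PDO.Dpow m) Wave.expXi := by
  ext1
  funext k
  rw [coeff_act_expXi, PDO.coeff_mul_Dpow, ← coeff_act_expXi S]
  rfl

theorem tderiv_act_expXi (S : PDO) (j : ℕ+) : (Wave.act S Wave.expXi).tderiv j =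
    Wave.act (S.tderiv j + S * PDO.Dpow (j : ℕ)) Wave.expXi := by
  ext1
  funext k
  rw [coeff_act_expXi, PDO.coeff_add, PDO.coeff_mul_Dpow, PDO.coeff_tderiv, ← coeff_act_expXi S]
  rfl

theorem PDO.IsDressing.isWaveFunction {S : PDO} (hS : S.IsDressing) (n : ℕ) :
    IsWaveFunction n (lax S ^ n) (lax S) (Wave.act S Wave.expXi) where
  leading := by rw [coeff_act_expXi, hS.monic.1]
  pos k hk := by rw [coeff_act_expXi, hS.monic.orderLE k hk]
  eigen := by rw [act_act_expXi, hS.monic.lax_pow_mul, zmul_act_expXi]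
  evolution j := by rw [act_act_expXi, tderiv_act_expXi, hS.tderiv_add_mul_Dpow]

/-! ### Stable limits -/

theorem wt_add (c d : ℕ+ →₀ ℕ) : wt (c + d) = wt c + wt d :=
  Finsupp.sum_add_index' (fun _ => rfl) fun _ _ _ => mul_add _ _ _

theorem wt_single (i : ℕ+) (m : ℕ) : wt (Finsupp.single i m) = i * m :=
  Finsupp.sum_single_index rfl

theorem wt_zero : wt 0 = 0 := rfl

/-- The ideal of series all of whose terms have degree at least `k`. -/
def weightIdeal (k : ℕ) : Ideal R where
  carrier := {f | ∀ d, wt d < k → MvPowerSeries.coeff d f = 0}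
  add_mem' hf hg d hd := by rw [map_add, hf d hd, hg d hd, add_zero]
  zero_mem' d _ := map_zero _
  smul_mem' c f hf d hd := by
    rw [smul_eq_mul, MvPowerSeries.coeff_mul]
    refine Finset.sum_eq_zero fun p hp => ?_
    rw [Finset.HasAntidiagonal.mem_antidiagonal] at hp
    rw [hf p.2 (by rw [← hp, wt_add] at hd; omega), mul_zero]

theorem mem_weightIdeal {k : ℕ} {f : R} :
    f ∈ weightIdeal k ↔ ∀ d, wt d < k → MvPowerSeries.coeff d f = 0 := Iff.rfl

theorem mul_mem_weightIdeal_add {j k : ℕ} {f g : R} (hf : f ∈ weightIdeal j)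
    (hg : g ∈ weightIdeal k) : f * g ∈ weightIdeal (j + k) := by
  intro d hd
  rw [MvPowerSeries.coeff_mul]
  refine Finset.sum_eq_zero fun p hp => ?_
  rw [Finset.HasAntidiagonal.mem_antidiagonal] at hp
  rw [← hp, wt_add] at hd
  rcases lt_or_ge (wt p.1) j with h | h
  · rw [hf _ h, zero_mul]
  · rw [hg _ (by omega), mul_zero]

theorem pd_mem_weightIdeal {k : ℕ} (j : ℕ+) {f : R} (hf : f ∈ weightIdeal (k + j)) :
    pd j f ∈ weightIdeal k := by
  intro d hd
  rw [MvPowerSeries.coeff_pderiv, hf _ (by rw [wt_add, wt_single]; omega), zero_mul]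

theorem isStableLimit_iff {f : ℕ → R} {F : R} :
    IsStableLimit f F ↔ ∀ k, ∀ᶠ N in atTop, f N - F ∈ weightIdeal k := by
  simp only [IsStableLimit, eventually_atTop, mem_weightIdeal, map_sub, sub_eq_zero]
  refine ⟨fun h k => ?_, fun h Q => ?_⟩
  · obtain ⟨N₀, hN₀⟩ := h k
    exact ⟨N₀, fun N hN d hd => hN₀ N hN d hd.le⟩
  · obtain ⟨N₀, hN₀⟩ := h (Q + 1)
    exact ⟨N₀, fun N hN d hd => hN₀ N hN d (Nat.lt_succ_of_le hd)⟩

namespace IsStableLimit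

variable {f g : ℕ → R} {F G : R}

theorem const (F : R) : IsStableLimit (fun _ => F) F := fun _ => ⟨0, fun _ _ _ _ => rfl⟩

theorem unique (hf : IsStableLimit f F) (hg : IsStableLimit f G) : F = G := by
  ext d
  obtain ⟨N, hN⟩ := hf (wt d)
  obtain ⟨N', hN'⟩ := hg (wt d)
  rw [← hN _ (le_max_left N N') d le_rfl, hN' _ (le_max_right N N') d le_rfl]

theorem comp_tendsto (hf : IsStableLimit f F) {u : ℕ → ℕ} (hu : Tendsto u atTop atTop) :
    IsStableLimit (fun N => f (u N)) F :=
  isStableLimit_iff.2 fun k => hu.eventually (isStableLimit_iff.1 hf k)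

theorem add (hf : IsStableLimit f F) (hg : IsStableLimit g G) :
    IsStableLimit (fun N => f N + g N) (F + G) := by
  refine isStableLimit_iff.2 fun k => ?_
  filter_upwards [isStableLimit_iff.1 hf k, isStableLimit_iff.1 hg k] with N hfN hgN
  rw [add_sub_add_comm]
  exact add_mem hfN hgN

theorem neg (hf : IsStableLimit f F) : IsStableLimit (fun N => -f N) (-F) := by
  refine isStableLimit_iff.2 fun k => ?_
  filter_upwards [isStableLimit_iff.1 hf k] with N hfN
  rw [← neg_sub', neg_mem_iff]
  exact hfN

theorem sub (hf : IsStableLimit f F) (hg : IsStableLimit g G) :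
    IsStableLimit (fun N => f N - g N) (F - G) := by
  simpa only [sub_eq_add_neg] using hf.add hg.neg

theorem mul (hf : IsStableLimit f F) (hg : IsStableLimit g G) :
    IsStableLimit (fun N => f N * g N) (F * G) := by
  refine isStableLimit_iff.2 fun k => ?_
  filter_upwards [isStableLimit_iff.1 hf k, isStableLimit_iff.1 hg k] with N hfN hgN
  rw [show f N * g N - F * G = g N * (f N - F) + F * (g N - G) by ring]
  exact add_mem (Ideal.mul_mem_left _ _ hfN) (Ideal.mul_mem_left _ _ hgN)

theorem mul_zero (f : ℕ → R) (hg : IsStableLimit g 0) : IsStableLimit (fun N => f N * g N) 0 := by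
  refine isStableLimit_iff.2 fun k => ?_
  filter_upwards [isStableLimit_iff.1 hg k] with N hgN
  rw [sub_zero] at hgN ⊢
  exact Ideal.mul_mem_left _ _ hgN

theorem zsmul (k : ℤ) (hf : IsStableLimit f F) : IsStableLimit (fun N => k • f N) (k • F) := by
  simpa only [zsmul_eq_mul] using (const (k : R)).mul hf

theorem sum {ι : Type*} (s : Finset ι) {f : ι → ℕ → R} {F : ι → R}
    (h : ∀ i ∈ s, IsStableLimit (f i) (F i)) :
    IsStableLimit (fun N => ∑ i ∈ s, f i N) (∑ i ∈ s, F i) := by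
  classical
  induction s using Finset.induction_on with
  | empty => exact const 0
  | insert a s ha ih =>
    simp only [Finset.sum_insert ha]
    exact (h a (Finset.mem_insert_self _ _)).add (ih fun i hi => h i (Finset.mem_insert_of_mem hi))

theorem pd (j : ℕ+) (hf : IsStableLimit f F) :
    IsStableLimit (fun N => pd j (f N)) (GelfandDickey.pd j F) := by
  refine isStableLimit_iff.2 fun k => ?_
  filter_upwards [isStableLimit_iff.1 hf (k + j)] with N hfN
  rw [← map_sub]
  exact pd_mem_weightIdeal j hfN

theorem D_iterate (l : ℕ) (hf : IsStableLimit f F) :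
    IsStableLimit (fun N => D^[l] (f N)) (D^[l] F) := by
  induction l with
  | zero => exact hf
  | succ l ih => simpa only [Function.iterate_succ_apply'] using ih.pd 1

theorem inv (hf : IsStableLimit f F) (h : ∀ N, MvPowerSeries.constantCoeff (f N) ≠ 0)
    (hF : MvPowerSeries.constantCoeff F ≠ 0) : IsStableLimit (fun N => (f N)⁻¹) F⁻¹ := by
  refine isStableLimit_iff.2 fun k => ?_
  filter_upwards [isStableLimit_iff.1 hf k] with N hfN
  have hinv := MvPowerSeries.mul_inv_cancel (f N) (h N)
  have hInv := MvPowerSeries.mul_inv_cancel F hF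
  rw [show (f N)⁻¹ - F⁻¹ = -((f N)⁻¹ * F⁻¹) * (f N - F) by
    linear_combination F⁻¹ * hinv - (f N)⁻¹ * hInv]
  exact Ideal.mul_mem_left _ _ hfN

end IsStableLimit

namespace PDO.IsStableLimit

variable {a b : ℕ → PDO} {A B : PDO} {K K' : ℤ}

theorem const (A : PDO) : PDO.IsStableLimit (fun _ => A) A :=
  fun k => GelfandDickey.IsStableLimit.const (A.coeff k)

theorem coeff_eq_zero (ha : PDO.IsStableLimit a A) {k : ℤ} (h : ∀ N, (a N).coeff k = 0) :
    A.coeff k = 0 := by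
  have hk := ha k
  simp only [h] at hk
  exact hk.unique (GelfandDickey.IsStableLimit.const 0)

theorem orderLE (ha : PDO.IsStableLimit a A) (h : ∀ N, OrderLE (a N).coeff K) : OrderLE A.coeff K :=
  fun k hk => ha.coeff_eq_zero fun N => h N k hk

theorem isMonic (ha : PDO.IsStableLimit a A) (h : ∀ N, (a N).IsMonic K) : A.IsMonic K := by
  refine ⟨?_, ha.orderLE fun N => (h N).orderLE⟩
  have hK := ha K
  simp only [(h _).1] at hK
  exact hK.unique (GelfandDickey.IsStableLimit.const 1)

theorem isDiff (ha : PDO.IsStableLimit a A) (h : ∀ N, (a N).IsDiff) : A.IsDiff :=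
  fun k hk => ha.coeff_eq_zero fun N => h N k hk

theorem sub (ha : PDO.IsStableLimit a A) (hb : PDO.IsStableLimit b B) :
    PDO.IsStableLimit (fun N => a N - b N) (A - B) := fun k => (ha k).sub (hb k)

theorem add (ha : PDO.IsStableLimit a A) (hb : PDO.IsStableLimit b B) :
    PDO.IsStableLimit (fun N => a N + b N) (A + B) := fun k => (ha k).add (hb k)

theorem tderiv (ha : PDO.IsStableLimit a A) (j : ℕ+) :
    PDO.IsStableLimit (fun N => (a N).tderiv j) (A.tderiv j) := fun k => (ha k).pd j

theorem comp_tendsto (ha : PDO.IsStableLimit a A) {u : ℕ → ℕ} (hu : Tendsto u atTop atTop) :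
    PDO.IsStableLimit (fun N => a (u N)) A := fun k => (ha k).comp_tendsto hu

theorem Dcomp (hb : PDO.IsStableLimit b B) (hbK : ∀ N, OrderLE (b N).coeff K') (i m : ℤ) :
    GelfandDickey.IsStableLimit (fun N => Dcomp i (b N).coeff m)
      (GelfandDickey.Dcomp i B.coeff m) := by
  set L := (K' - m + i + 1).toNat
  rw [Dcomp_eq_sum (hb.orderLE hbK) i m (L := L) (by omega)]
  simp only [fun N => Dcomp_eq_sum (hbK N) i m (L := L) (by omega)]
  exact GelfandDickey.IsStableLimit.sum _ fun l _ => ((hb _).D_iterate l).zsmul _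

theorem mul (ha : PDO.IsStableLimit a A) (haK : ∀ N, OrderLE (a N).coeff K)
    (hb : PDO.IsStableLimit b B) (hbK : ∀ N, OrderLE (b N).coeff K') :
    PDO.IsStableLimit (fun N => a N * b N) (A * B) := by
  intro m
  simp only [coeff_mul, fun N => leibniz_eq_sum (haK N) (hbK N) m le_rfl le_rfl,
    leibniz_eq_sum (ha.orderLE haK) (hb.orderLE hbK) m le_rfl le_rfl]
  exact GelfandDickey.IsStableLimit.sum _ fun i _ => (ha i).mul (hb.Dcomp hbK i m)

theorem mul_zero (haK : ∀ N, OrderLE (a N).coeff K)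
    (hb : PDO.IsStableLimit b 0) (hbK : ∀ N, OrderLE (b N).coeff K') :
    PDO.IsStableLimit (fun N => a N * b N) 0 := by
  intro m
  simp only [coeff_mul, fun N => leibniz_eq_sum (haK N) (hbK N) m le_rfl le_rfl]
  rw [coeff_zero, ← Finset.sum_const_zero (s := Finset.Icc (m - K') K)]
  refine GelfandDickey.IsStableLimit.sum _ fun i _ => ?_
  refine GelfandDickey.IsStableLimit.mul_zero _ ?_
  have hDcomp := hb.Dcomp hbK i m
  rwa [show GelfandDickey.Dcomp i (PDO.coeff 0) m = 0 by
    rw [← coeff_Dpow_mul, MulZeroClass.mul_zero, coeff_zero]] at hDcomp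

theorem inv (ha : PDO.IsStableLimit a A) (h : ∀ N, (a N).IsMonic 0) :
    PDO.IsStableLimit (fun N => (a N)⁻¹) A⁻¹ := by
  have hA := ha.isMonic h
  have inv_sub_inv : ∀ N, (a N)⁻¹ - A⁻¹ = (a N)⁻¹ * ((A - a N) * A⁻¹) := fun N => by
    rw [sub_mul, mul_sub, hA.mul_inv_cancel, ← mul_assoc _ (a N), (h N).inv_mul_cancel, mul_one,
      one_mul]
  have order_diff : ∀ N, OrderLE (A - a N).coeff 0 := fun N => hA.orderLE.sub (h N).orderLE
  have lim_diff : PDO.IsStableLimit (fun N => (A - a N) * A⁻¹) 0 := by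
    simpa only [sub_self, zero_mul] using
      ((const A).sub ha).mul order_diff (const A⁻¹) fun _ => hA.inv.orderLE
  have lim_inv := (mul_zero (fun N => (h N).inv.orderLE) lim_diff
    fun N => (order_diff N).mul hA.inv.orderLE).add (const A⁻¹)
  simpa only [← inv_sub_inv, sub_add_cancel, zero_add] using lim_inv

theorem pow (ha : PDO.IsStableLimit a A) (h : ∀ N, (a N).IsMonic K) (k : ℕ) :
    PDO.IsStableLimit (fun N => a N ^ k) (A ^ k) := by
  induction k with
  | zero => simpa only [pow_zero] using const 1
  | succ k ih =>
    simp only [pow_succ]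
    exact ih.mul (fun N => ((h N).pow k).orderLE) ha fun N => (h N).orderLE

theorem lax (ha : PDO.IsStableLimit a A) (h : ∀ N, (a N).IsMonic 0) :
    PDO.IsStableLimit (fun N => lax (a N)) (lax A) :=
  (ha.mul (fun N => (h N).orderLE) (const _) fun _ => orderLE_Dpow 1).mul
    (fun N => ((h N).mul (isMonic_Dpow 1)).orderLE) (ha.inv h) fun N => (h N).inv.orderLE

/-- The operators `B_j` are recovered as `(∂S/∂t_j + S D ^ j) S⁻¹`, so they converge as well. -/
theorem isDressing (ha : PDO.IsStableLimit a A) (h : ∀ N, (a N).IsDressing) : A.IsDressing := by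
  have hm := fun N => (h N).monic
  have hA := ha.isMonic hm
  refine ⟨hA, fun j => ⟨(A.tderiv j + A * Dpow (j : ℕ)) * A⁻¹, ?_, ?_⟩⟩
  · have order : ∀ N, OrderLE ((a N).tderiv j + a N * Dpow (j : ℕ)).coeff (j : ℕ) := fun N =>
      OrderLE.add (((hm N).orderLE_tderiv j).mono (by omega))
        (((hm N).orderLE.mul (orderLE_Dpow _)).mono (by omega))
    refine (((ha.tderiv j).add (ha.mul (fun N => (hm N).orderLE) (const _)
      fun _ => orderLE_Dpow (j : ℕ))).mul order (ha.inv hm) fun N => (hm N).inv.orderLE).isDiff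
        fun N => ?_
    obtain ⟨B, hB, hBa⟩ := (h N).sato j
    rwa [hBa, mul_assoc, (hm N).mul_inv_cancel, mul_one]
  · rw [mul_assoc, hA.inv_mul_cancel, mul_one]

theorem isDiff_lax_pow (ha : PDO.IsStableLimit a A) (h : ∀ N, (a N).IsMonic 0) {n : ℕ}
    (hsucc : ∀ N, ∃ B : PDO, B.IsDiff ∧ a (N + 1) * Dpow n = B * a N) : (PDO.lax A ^ n).IsDiff := by
  rw [(ha.isMonic h).lax_pow]
  refine (((ha.comp_tendsto (tendsto_add_atTop_nat 1)).mul (fun N => (h _).orderLE) (const _)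
    fun _ => orderLE_Dpow n).mul (fun N => ((h _).mul (isMonic_Dpow n)).orderLE) (ha.inv h)
      fun N => (h N).inv.orderLE).isDiff fun N => ?_
  obtain ⟨B, hB, hBa⟩ := hsucc N
  rwa [hBa, mul_assoc, (h N).mul_inv_cancel, mul_one]

theorem act_expXi (ha : PDO.IsStableLimit a A) :
    Wave.IsStableLimit (fun N => Wave.act (a N) Wave.expXi) (Wave.act A Wave.expXi) := by
  intro k
  simp only [coeff_act_expXi]
  exact ha k

end PDO.IsStableLimit

/-! ### The shift `t ↦ t - [z⁻¹]` -/

theorem mul_le_wt (c : ℕ+ →₀ ℕ) (i : ℕ+) : (i : ℕ) * c i ≤ wt c := by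
  by_cases h : i ∈ c.support
  · exact Finset.single_le_sum (f := fun i : ℕ+ => (i : ℕ) * c i) (fun _ _ => Nat.zero_le _) h
  · rw [Finsupp.notMem_support_iff.1 h, mul_zero]
    exact Nat.zero_le _

theorem wt_eq_zero_iff {c : ℕ+ →₀ ℕ} : wt c = 0 ↔ c = 0 := by
  refine ⟨fun h => Finsupp.ext fun i => ?_, fun h => by rw [h, wt_zero]⟩
  have hi := mul_le_wt c i
  rw [h, Nat.le_zero, Nat.mul_eq_zero] at hi
  exact hi.resolve_left i.ne_zero

theorem support_subset_of_wt_le {c : ℕ+ →₀ ℕ} {m : ℕ} (h : wt c ≤ m) :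
    c.support ⊆ (Finset.range m).image Nat.succPNat := by
  intro i hi
  have hci : 0 < c i := Nat.pos_of_ne_zero (Finsupp.mem_support_iff.1 hi)
  have him : (i : ℕ) ≤ m := (Nat.le_mul_of_pos_right _ hci).trans ((mul_le_wt c i).trans h)
  have hpred := i.natPred_add_one
  exact Finset.mem_image.2 ⟨i.natPred, Finset.mem_range.2 (by omega), PNat.succPNat_natPred i⟩

theorem wt_eq_sum_range {c : ℕ+ →₀ ℕ} {m : ℕ} (h : wt c ≤ m) :
    wt c = ∑ k ∈ Finset.range m, (k + 1) * c k.succPNat := by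
  rw [wt, Finsupp.sum_of_support_subset c (support_subset_of_wt_le h) _ fun _ _ => rfl,
    Finset.sum_image Nat.succPNat_injective.injOn]
  rfl

theorem finite_wt_eq (m : ℕ) : {c : ℕ+ →₀ ℕ | wt c = m}.Finite := by
  refine (((Finset.range m).image Nat.succPNat).finsupp fun _ =>
    Finset.range (m + 1)).finite_toSet.subset fun c hc => ?_
  rw [Set.mem_ofPred_eq] at hc
  refine Finset.mem_finsupp_iff.2 ⟨support_subset_of_wt_le hc.le, fun i _ => ?_⟩
  rw [Finset.mem_range, Nat.lt_succ_iff]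
  exact (Nat.le_mul_of_pos_left _ i.pos).trans ((mul_le_wt c i).trans hc.le)

/-- The exponents of the monomials of degree `m`. -/
def exponentsOfWt (m : ℕ) : Finset (ℕ+ →₀ ℕ) := (finite_wt_eq m).toFinset

theorem mem_exponentsOfWt {m : ℕ} {c : ℕ+ →₀ ℕ} : c ∈ exponentsOfWt m ↔ wt c = m :=
  (finite_wt_eq m).mem_toFinset

theorem exponentsOfWt_zero : exponentsOfWt 0 = {0} := by
  ext c
  rw [mem_exponentsOfWt, Finset.mem_singleton, wt_eq_zero_iff]

/-- The coefficient of `t ^ d s ^ c` in `∏ (tᵢ - sᵢ / i) ^ (dᵢ + cᵢ)`. -/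
def shiftCoeff (d c : ℕ+ →₀ ℕ) : ℂ :=
  c.prod fun i k => ((d i + k).choose k : ℂ) * (-1 / (i : ℂ)) ^ k

theorem coeff_miwa (f : R) (m : ℕ) (d : ℕ+ →₀ ℕ) :
    MvPowerSeries.coeff d (miwa f m) =
      ∑ c ∈ exponentsOfWt m, MvPowerSeries.coeff (d + c) f * shiftCoeff d c := by
  change (∑ᶠ (c : ℕ+ →₀ ℕ) (_ : c ∈ {c | wt c = m}), MvPowerSeries.coeff (d + c) f *
    shiftCoeff d c) = _
  rw [finsum_mem_eq_finite_toFinset_sum _ (finite_wt_eq m)]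
  rfl

theorem shiftCoeff_add_single (d c : ℕ+ →₀ ℕ) (i : ℕ+) :
    (i : ℂ) * (c i + 1) * shiftCoeff d (c + Finsupp.single i 1) =
      -((d i + c i + 1) * shiftCoeff d c) := by
  have factor_zero : ∀ j : ℕ+, ((d j + 0).choose 0 : ℂ) * (-1 / (j : ℂ)) ^ 0 = 1 := by simp
  have hchoose : (((d i + c i + 1).choose (c i + 1) : ℕ) : ℂ) * (c i + 1) =
      (d i + c i + 1) * ((d i + c i).choose (c i) : ℕ) := by
    exact_mod_cast (Nat.add_one_mul_choose_eq (d i + c i) (c i)).symm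
  have hi : (i : ℂ) * (-1 / i) = -1 := mul_div_cancel₀ _ (by exact_mod_cast i.ne_zero)
  rw [shiftCoeff, shiftCoeff, ← Finsupp.mul_prod_erase' _ i _ factor_zero,
    ← Finsupp.mul_prod_erase' c i _ factor_zero, Finsupp.erase_add, Finsupp.erase_single, add_zero,
    Finsupp.add_apply, Finsupp.single_eq_same, ← add_assoc, pow_succ]
  set P := (c.erase i).prod fun j k => ((d j + k).choose k : ℂ) * (-1 / (j : ℂ)) ^ k
  linear_combination (-1 / (i : ℂ)) ^ c i * P *
    ((i : ℂ) * (-1 / i) * hchoose + (d i + c i + 1) * ((d i + c i).choose (c i) : ℕ) * hi)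

theorem sum_exponentsOfWt_add (i : ℕ+) (m : ℕ) {X : (ℕ+ →₀ ℕ) → ℂ}
    (hX : ∀ c, c i = 0 → X c = 0) :
    ∑ c ∈ exponentsOfWt (m + i), X c = ∑ c ∈ exponentsOfWt m, X (c + Finsupp.single i 1) := by
  symm
  refine Finset.sum_of_injOn (fun c => c + Finsupp.single i 1) (add_left_injective _).injOn
    (fun c hc => ?_) (fun c hc not_mem_image => hX c ?_) fun _ _ => rfl
  · rw [Finset.mem_coe, mem_exponentsOfWt] at hc ⊢
    rw [wt_add, wt_single, hc, mul_one]
  · by_contra hci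
    have hle : Finsupp.single i 1 ≤ c := Finsupp.single_le_iff.2 (Nat.one_le_iff_ne_zero.2 hci)
    refine not_mem_image ⟨c - Finsupp.single i 1, ?_, tsub_add_cancel_of_le hle⟩
    have hwt := wt_add (c - Finsupp.single i 1) (Finsupp.single i 1)
    rw [tsub_add_cancel_of_le hle, wt_single, mem_exponentsOfWt.1 hc] at hwt
    rw [Finset.mem_coe, mem_exponentsOfWt]
    omega

/-- Differentiate `τ(t - [x])` with respect to `x`. On coefficients this is the Euler identity
`∑ i cᵢ = wt c`. -/
theorem miwa_succ (f : R) (m : ℕ) :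
    ((m + 1 : ℕ) : ℂ) • miwa f (m + 1) =
      -∑ k ∈ Finset.range (m + 1), miwa (pd k.succPNat f) (m - k) := by
  ext d
  rw [MvPowerSeries.coeff_smul, coeff_miwa, map_neg, map_sum, Finset.mul_sum]
  have euler : ∀ c ∈ exponentsOfWt (m + 1), ((m + 1 : ℕ) : ℂ) *
      (MvPowerSeries.coeff (d + c) f * shiftCoeff d c) = ∑ k ∈ Finset.range (m + 1),
        MvPowerSeries.coeff (d + c) f * (((k.succPNat : ℕ) : ℂ) * c k.succPNat *
          shiftCoeff d c) := by
    intro c hc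
    rw [mem_exponentsOfWt] at hc
    have wt_eq : ((m + 1 : ℕ) : ℂ) =
        ∑ k ∈ Finset.range (m + 1), ((k.succPNat : ℕ) : ℂ) * c k.succPNat := by
      conv_lhs => rw [← hc, wt_eq_sum_range hc.le]
      simp only [Nat.cast_sum, Nat.cast_mul, Nat.succPNat_coe, Nat.succ_eq_add_one]
    rw [← Finset.mul_sum, ← Finset.sum_mul, ← wt_eq]
    ring
  rw [Finset.sum_congr rfl euler, Finset.sum_comm, ← Finset.sum_neg_distrib]
  refine Finset.sum_congr rfl fun k hk => ?_
  rw [Finset.mem_range] at hk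
  have hm : m + 1 = m - k + (k.succPNat : ℕ) := by rw [Nat.succPNat_coe]; omega
  rw [hm, sum_exponentsOfWt_add _ _ fun c hc => by
    rw [hc, Nat.cast_zero, mul_zero, zero_mul, mul_zero], coeff_miwa, ← Finset.sum_neg_distrib]
  refine Finset.sum_congr rfl fun c _ => ?_
  have hshift := shiftCoeff_add_single d c k.succPNat
  rw [MvPowerSeries.coeff_pderiv, ← add_assoc]
  simp only [Finsupp.add_apply, Finsupp.single_eq_same, Nat.cast_add, Nat.cast_one] at hshift ⊢
  linear_combination (MvPowerSeries.coeff (d + c + Finsupp.single k.succPNat 1) f) * hshift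

theorem miwa_zero (f : R) : miwa f 0 = f := by
  ext d
  rw [coeff_miwa, exponentsOfWt_zero, Finset.sum_singleton, add_zero, shiftCoeff,
    Finsupp.prod_zero_index, mul_one]

theorem IsStableLimit.miwa {f : ℕ → R} {F : R} (hf : IsStableLimit f F) (m : ℕ) :
    IsStableLimit (fun N => miwa (f N) m) (GelfandDickey.miwa F m) := by
  intro Q
  obtain ⟨N₀, h⟩ := hf (Q + m)
  refine ⟨N₀, fun N hN d hd => ?_⟩
  rw [coeff_miwa, coeff_miwa]
  refine Finset.sum_congr rfl fun c hc => ?_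
  rw [mem_exponentsOfWt] at hc
  rw [h N hN _ (by rw [wt_add]; omega)]

/-- `τ ↦ τ(t - [x])`, as a series in `x = z⁻¹`. See `miwaHom` for its multiplicativity. -/
def miwaAddHom : R →+ PowerSeries R where
  toFun f := PowerSeries.mk (miwa f)
  map_zero' := by
    ext m d
    simp only [PowerSeries.coeff_mk, coeff_miwa, map_zero, zero_mul, Finset.sum_const_zero]
  map_add' f g := by
    ext m d
    simp only [map_add, PowerSeries.coeff_mk, coeff_miwa, add_mul, Finset.sum_add_distrib]

theorem coeff_miwaAddHom (f : R) (m : ℕ) : PowerSeries.coeff m (miwaAddHom f) = miwa f m :=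
  PowerSeries.coeff_mk m (miwa f)

theorem constantCoeff_miwaAddHom (f : R) : PowerSeries.constantCoeff (miwaAddHom f) = f := by
  rw [← PowerSeries.coeff_zero_eq_constantCoeff_apply, coeff_miwaAddHom, miwa_zero]

instance : IsAddTorsionFree R := inferInstanceAs (IsAddTorsionFree ((ℕ+ →₀ ℕ) → ℂ))

open PowerSeries in
theorem X_pow_succ_dvd_of_derivative {A : Type*} [CommRing A] [IsAddTorsionFree A] {m : ℕ}
    {F : A⟦X⟧} (h0 : constantCoeff F = 0) (hF : X ^ m ∣ d⁄dX A F) : X ^ (m + 1) ∣ F := by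
  rw [X_pow_dvd_iff] at hF ⊢
  rintro (_ | l) hl
  · rwa [coeff_zero_eq_constantCoeff_apply]
  · have hcoeff := hF l (by omega)
    rw [coeff_derivative, ← Nat.cast_succ, mul_comm, ← nsmul_eq_mul] at hcoeff
    exact (nsmul_eq_zero_iff_right l.succ_ne_zero).1 hcoeff

open PowerSeries in
theorem X_pow_dvd_derivative_miwaAddHom (f : R) (m : ℕ) :
    X ^ m ∣ d⁄dX R (miwaAddHom f) +
      ∑ k ∈ Finset.range m, X ^ k * miwaAddHom (pd k.succPNat f) := by
  refine X_pow_dvd_iff.2 fun l hl => ?_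
  have hsum : coeff l (∑ k ∈ Finset.range m, X ^ k * miwaAddHom (pd k.succPNat f)) =
      ∑ k ∈ Finset.range (l + 1), miwa (pd k.succPNat f) (l - k) := by
    simp only [map_sum, coeff_X_pow_mul', coeff_miwaAddHom]
    rw [← Finset.sum_filter]
    refine Finset.sum_congr ?_ fun _ _ => rfl
    ext k
    simp only [Finset.mem_filter, Finset.mem_range]
    omega
  have hmiwa := miwa_succ f l
  rw [Nat.cast_smul_eq_nsmul, nsmul_eq_mul, Nat.cast_succ] at hmiwa
  rw [map_add, hsum, coeff_derivative, coeff_miwaAddHom, mul_comm, hmiwa, neg_add_cancel]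

open PowerSeries in
theorem eq_of_forall_X_pow_dvd_sub {A : Type*} [CommRing A] {F G : A⟦X⟧}
    (h : ∀ m, X ^ m ∣ F - G) : F = G := by
  ext1 m
  rw [← sub_eq_zero, ← map_sub]
  exact X_pow_dvd_iff.1 (h (m + 1)) m m.lt_succ_self

open PowerSeries in
theorem miwaAddHom_mul (f g : R) : miwaAddHom (f * g) = miwaAddHom f * miwaAddHom g := by
  refine eq_of_forall_X_pow_dvd_sub fun m => ?_
  induction m generalizing f g with
  | zero => rw [pow_zero]; exact one_dvd _
  | succ m ih =>
    refine X_pow_succ_dvd_of_derivative ?_ ?_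
    · simp only [map_sub, map_mul, constantCoeff_miwaAddHom, sub_self]
    · set S := fun h : R => ∑ k ∈ Finset.range m, X ^ k * miwaAddHom (pd k.succPNat h)
      have leibniz_rule : X ^ m ∣ S (f * g) - (S f * miwaAddHom g + miwaAddHom f * S g) := by
        simp only [S, Finset.sum_mul, Finset.mul_sum, ← Finset.sum_add_distrib,
          ← Finset.sum_sub_distrib]
        refine Finset.dvd_sum fun k _ => ?_
        have hk := dvd_add (ih (pd k.succPNat f) g) (ih f (pd k.succPNat g))
        convert! hk.mul_left (X ^ k) using 1
        rw [pd_mul, map_add]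
        ring
      have hfg := X_pow_dvd_derivative_miwaAddHom (f * g) m
      have hf := (X_pow_dvd_derivative_miwaAddHom f m).mul_right (miwaAddHom g)
      have hg := (X_pow_dvd_derivative_miwaAddHom g m).mul_left (miwaAddHom f)
      convert! ((hfg.sub hf).sub hg).sub leibniz_rule using 1
      simp only [S, map_sub, Derivation.leibniz, smul_eq_mul]
      ring

theorem miwaAddHom_one : miwaAddHom 1 = 1 := by
  ext1 m
  rw [coeff_miwaAddHom, PowerSeries.coeff_one]
  rcases m with _ | m
  · rw [miwa_zero, if_pos rfl]
  · have hm : ((m + 1 : ℕ) : ℂ) ≠ 0 := by exact_mod_cast m.succ_ne_zero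
    rw [if_neg m.succ_ne_zero, ← smul_eq_zero_iff_right hm, miwa_succ, neg_eq_zero]
    refine Finset.sum_eq_zero fun k _ => ?_
    rw [show pd k.succPNat (1 : R) = 0 from MvPowerSeries.pderiv_one, ← coeff_miwaAddHom, map_zero,
      map_zero]

/-- The substitution `τ ↦ τ(t - [x])` as a ring homomorphism, where `x = z⁻¹`. -/
def miwaHom : R →+* PowerSeries R :=
  { miwaAddHom with
    map_one' := miwaAddHom_one
    map_mul' := miwaAddHom_mul }

theorem coeff_miwaHom (f : R) (m : ℕ) : PowerSeries.coeff m (miwaHom f) = miwa f m :=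
  coeff_miwaAddHom f m

open PowerSeries in
/-- Modulo `x ^ m`, the derivative of the left side is a telescoping sum. -/
theorem miwaHom_of_pd {g : ℤ → R} (hg : ∀ (j : ℕ+) (a : ℤ), pd j (g a) = g (a - (j : ℕ)))
    (a : ℤ) : miwaHom (g a) = C (g a) - X * C (g (a - 1)) := by
  change miwaAddHom (g a) = _
  refine eq_of_forall_X_pow_dvd_sub fun m => ?_
  induction m generalizing a with
  | zero => rw [pow_zero]; exact one_dvd _
  | succ m ih =>
    refine X_pow_succ_dvd_of_derivative (by simp [constantCoeff_miwaAddHom]) ?_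
    set S := ∑ k ∈ Finset.range m, X ^ k * miwaAddHom (pd k.succPNat (g a))
    have telescope : X ^ m ∣ S - (C (g (a - 1)) - X ^ m * C (g (a - 1 - m))) := by
      have hsum := Finset.sum_range_sub' (fun k : ℕ => X ^ k * C (g (a - 1 - k))) m
      rw [pow_zero, one_mul, Nat.cast_zero, sub_zero] at hsum
      rw [← hsum, ← Finset.sum_sub_distrib]
      refine Finset.dvd_sum fun k _ => ?_
      convert! (ih (a - 1 - k)).mul_left (X ^ k) using 1
      rw [hg, Nat.succPNat_coe, show a - ((k.succ : ℕ) : ℤ) = a - 1 - k by push_cast; ring,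
        show a - 1 - ((k + 1 : ℕ) : ℤ) = a - 1 - k - 1 by push_cast; ring]
      ring
    have hderiv := ((X_pow_dvd_derivative_miwaAddHom (g a) m).sub telescope).add
      (dvd_mul_right (X ^ m) (C (g (a - 1 - m))))
    convert! hderiv using 1
    simp only [S, map_sub, Derivation.leibniz, derivative_C, derivative_X, smul_eq_mul]
    ring

/-! ### Exponential moments and the `τ`-function -/

/-- The product of the inverse factorials of the exponents. -/
def invFactorial (d : ℕ+ →₀ ℕ) : ℂ := d.prod fun _ m => ((m.factorial : ℂ))⁻¹

theorem invFactorial_add_single (d : ℕ+ →₀ ℕ) (i : ℕ+) :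
    invFactorial (d + Finsupp.single i 1) * (d i + 1) = invFactorial d := by
  have factor_zero : ∀ _ : ℕ+, ((Nat.factorial 0 : ℂ))⁻¹ = 1 := by simp
  have hd : (d i + 1 : ℂ) ≠ 0 := by exact_mod_cast (d i).succ_ne_zero
  have hfactorial : ((d i).factorial : ℂ) ≠ 0 := by exact_mod_cast (d i).factorial_ne_zero
  rw [invFactorial, invFactorial, ← Finsupp.mul_prod_erase' _ i _ factor_zero,
    ← Finsupp.mul_prod_erase' d i _ factor_zero, Finsupp.erase_add, Finsupp.erase_single, add_zero,
    Finsupp.add_apply, Finsupp.single_eq_same, Nat.factorial_succ, Nat.cast_mul, Nat.cast_succ]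
  field_simp

/-- The coefficient of `z ^ a` in `exp ξ(t,z) ∑ c_l z ^ l`, that is, the series
`∑_d t ^ d / d! * c_{a - wt d}`. -/
def expCoeff (c : ℤ → ℂ) (a : ℤ) : R := fun d => invFactorial d * c (a - wt d)

theorem coeff_expCoeff (c : ℤ → ℂ) (a : ℤ) (d : ℕ+ →₀ ℕ) :
    MvPowerSeries.coeff d (expCoeff c a) = invFactorial d * c (a - wt d) := rfl

theorem expCoeff_add (c c' : ℤ → ℂ) (a : ℤ) :
    expCoeff (c + c') a = expCoeff c a + expCoeff c' a := by
  ext d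
  simp only [map_add, coeff_expCoeff, Pi.add_apply, mul_add]

theorem pd_expCoeff (c : ℤ → ℂ) (j : ℕ+) (a : ℤ) :
    pd j (expCoeff c a) = expCoeff c (a - (j : ℕ)) := by
  ext d
  rw [MvPowerSeries.coeff_pderiv, coeff_expCoeff, coeff_expCoeff, ← invFactorial_add_single d j,
    wt_add, wt_single, show a - ((wt d + j * 1 : ℕ) : ℤ) = a - (j : ℕ) - wt d by push_cast; ring]
  ring

theorem D_iterate_expCoeff (c : ℤ → ℂ) (k : ℕ) (a : ℤ) :
    D^[k] (expCoeff c a) = expCoeff c (a - k) := by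
  induction k generalizing a with
  | zero => rw [Function.iterate_zero_apply, Nat.cast_zero, sub_zero]
  | succ k ih =>
    rw [Function.iterate_succ_apply, D, pd_expCoeff, ih, PNat.one_coe, Nat.cast_one, Nat.cast_succ,
      sub_sub, add_comm]

/-- The elementary Schur polynomials. -/
def schur (k : ℕ) : R := expCoeff (fun l => if l = 0 then 1 else 0) k

theorem coeff_schur (k : ℕ) (d : ℕ+ →₀ ℕ) :
    MvPowerSeries.coeff d (schur k) = if wt d = k then invFactorial d else 0 := by
  rw [schur, coeff_expCoeff]
  by_cases h : wt d = k
  · rw [if_pos (by omega), if_pos h, mul_one]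
  · rw [if_neg (by omega), if_neg h, mul_zero]

theorem schur_zero : schur 0 = 1 := by
  ext d
  simp only [coeff_schur, MvPowerSeries.coeff_one, wt_eq_zero_iff]
  refine ite_congr rfl (fun h => ?_) fun _ => rfl
  rw [h, invFactorial, Finsupp.prod_zero_index]

/-- The coefficients of `exp (-ξ(t,z))`. -/
def schurInv (k : ℕ) : R :=
  PowerSeries.coeff k (PowerSeries.invOfUnit (PowerSeries.mk schur) 1)

theorem mk_schurInv_mul : PowerSeries.mk schurInv * PowerSeries.mk schur = 1 := by
  have h : PowerSeries.mk schurInv = PowerSeries.invOfUnit (PowerSeries.mk schur) 1 := by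
    ext1 k
    rw [PowerSeries.coeff_mk, schurInv]
  rw [h, mul_comm]
  refine PowerSeries.mul_invOfUnit _ _ ?_
  rw [← PowerSeries.coeff_zero_eq_constantCoeff_apply, PowerSeries.coeff_mk, schur_zero,
    Units.val_one]

theorem schurInv_zero : schurInv 0 = 1 := by
  have h := congrArg (PowerSeries.coeff 0) mk_schurInv_mul
  simpa [PowerSeries.coeff_mul, schur_zero] using h

theorem schur_mem_weightIdeal (k : ℕ) : schur k ∈ weightIdeal k := by
  intro d hd
  rw [coeff_schur, if_neg (by omega)]

theorem schurInv_mem_weightIdeal (k : ℕ) : schurInv k ∈ weightIdeal k := by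
  induction k using Nat.strong_induction_on with
  | _ k ih =>
    rcases k with _ | k
    · exact fun d hd => absurd hd (Nat.not_lt_zero _)
    · have h := congrArg (PowerSeries.coeff (k + 1)) mk_schurInv_mul
      rw [PowerSeries.coeff_mul, Finset.Nat.sum_antidiagonal_succ', PowerSeries.coeff_one,
        if_neg k.succ_ne_zero] at h
      simp only [PowerSeries.coeff_mk, schur_zero, mul_one] at h
      rw [eq_neg_of_add_eq_zero_left h]
      refine neg_mem (sum_mem fun p hp => ?_)
      rw [Finset.HasAntidiagonal.mem_antidiagonal] at hp
      rw [← hp, add_assoc]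
      exact mul_mem_weightIdeal_add (ih p.1 (by omega)) (schur_mem_weightIdeal (p.2 + 1))

theorem expCoeff_mem_weightIdeal {c : ℤ → ℂ} (hc : ∀ l ≥ 0, c l = 0) (b : ℕ) :
    expCoeff c b ∈ weightIdeal (b + 1) := by
  intro d hd
  rw [coeff_expCoeff, hc _ (by omega), mul_zero]

theorem mk_expCoeff {c : ℤ → ℂ} (hc : ∀ l < 0, c l = 0) :
    PowerSeries.mk (fun b : ℕ => expCoeff c b) =
      PowerSeries.mk schur * PowerSeries.mk fun l : ℕ => (MvPowerSeries.C (c l) : R) := by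
  ext1 b
  rw [PowerSeries.coeff_mul, PowerSeries.coeff_mk]
  ext d
  simp only [PowerSeries.coeff_mk, map_sum, MvPowerSeries.coeff_mul_C, coeff_expCoeff, coeff_schur]
  rcases le_or_gt (wt d) b with h | h
  · rw [Finset.sum_eq_single_of_mem (wt d, b - wt d)
      (by rw [Finset.HasAntidiagonal.mem_antidiagonal]; omega), if_pos rfl, Nat.cast_sub h]
    rintro ⟨x, y⟩ hxy hne
    rw [Finset.HasAntidiagonal.mem_antidiagonal] at hxy
    rw [if_neg, zero_mul]
    rintro rfl
    exact hne (Prod.ext rfl (by dsimp only at hxy ⊢; omega))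
  · rw [hc _ (by omega), mul_zero]
    refine (Finset.sum_eq_zero fun p hp => ?_).symm
    rw [Finset.HasAntidiagonal.mem_antidiagonal] at hp
    rw [if_neg (by omega), zero_mul]

/-- Multiply `exp ξ ∑ c_l z ^ l` by `exp (-ξ)`: the nonnegative part of `c` contributes `c_M`, the
negative part only terms of degree greater than `M`. -/
theorem sum_schurInv_mul_expCoeff (c : ℤ → ℂ) (M : ℕ) :
    ∑ p ∈ Finset.HasAntidiagonal.antidiagonal M, schurInv p.1 * expCoeff c (p.2 : ℕ) -
      MvPowerSeries.C (c M) ∈ weightIdeal (M + 1) := by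
  set c₁ : ℤ → ℂ := fun l => if l < 0 then 0 else c l
  set c₂ : ℤ → ℂ := fun l => if l < 0 then c l else 0
  have hc : c = c₁ + c₂ := by
    funext l
    by_cases h : l < 0 <;> simp [c₁, c₂, h]
  have nonneg_part := congrArg (fun f => PowerSeries.coeff M (PowerSeries.mk schurInv * f))
    (mk_expCoeff (c := c₁) fun l hl => if_pos hl)
  rw [← mul_assoc, mk_schurInv_mul, one_mul, PowerSeries.coeff_mk, PowerSeries.coeff_mul,
    show c₁ M = c M from if_neg (by omega)] at nonneg_part
  simp only [PowerSeries.coeff_mk] at nonneg_part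
  rw [hc]
  simp only [expCoeff_add, mul_add, Finset.sum_add_distrib]
  rw [nonneg_part, ← hc, add_sub_cancel_left]
  refine sum_mem fun p hp => ?_
  rw [Finset.HasAntidiagonal.mem_antidiagonal] at hp
  rw [← hp, add_assoc]
  exact mul_mem_weightIdeal_add (schurInv_mem_weightIdeal p.1)
    (expCoeff_mem_weightIdeal (fun l hl => if_neg (by omega)) p.2)

/-- The `M × M` determinant `det [∮ z ^ (-i) exp ξ(t,z) ω_j dz]`, where `ω_j = ∑ c_{j,l} z ^ l`. -/
def tauDet (c : ℕ → ℤ → ℂ) (M : ℕ) : R :=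
  (Matrix.of fun i j : Fin M => expCoeff (c j) (i : ℕ)).det

/-- `c_j = z ^ j + (lower powers of z)` for all `j`. -/
structure IsUnitriangular (c : ℕ → ℤ → ℂ) : Prop where
  eq_zero : ∀ (j : ℕ) (l : ℤ), (j : ℤ) < l → c j l = 0
  eq_one : ∀ j : ℕ, c j j = 1

theorem det_sub_det_submatrix_castSucc_mem {A : Type*} [CommRing A] {I : Ideal A} {M : ℕ}
    {B : Matrix (Fin (M + 1)) (Fin (M + 1)) A} (hlast : B (Fin.last M) (Fin.last M) - 1 ∈ I)
    (hrow : ∀ j : Fin M, B (Fin.last M) j.castSucc ∈ I) :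
    B.det - (B.submatrix Fin.castSucc Fin.castSucc).det ∈ I := by
  rw [Matrix.det_succ_row B (Fin.last M), Fin.sum_univ_castSucc, add_sub_assoc]
  refine I.add_mem (sum_mem fun j _ => I.mul_mem_right _ (I.mul_mem_left _ (hrow j))) ?_
  simp only [Fin.val_last, Even.neg_one_pow ⟨M, rfl⟩, one_mul, Fin.succAbove_last]
  rw [← sub_one_mul]
  exact I.mul_mem_right _ hlast

/-- Multiplication of the last row by the coefficients of `exp (-ξ)` makes it `(0, …, 0, 1)` up to
terms of high degree. -/
theorem tauDet_succ_sub_mem {c : ℕ → ℤ → ℂ} (hc : IsUnitriangular c) (M : ℕ) :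
    tauDet c (M + 1) - tauDet c M ∈ weightIdeal (M + 1) := by
  set A : Matrix (Fin (M + 1)) (Fin (M + 1)) R := Matrix.of fun i j => expCoeff (c j) (i : ℕ)
  set v : Fin (M + 1) → R := ∑ k : Fin (M + 1), schurInv (M - k) • A k
  set B := A.updateRow (Fin.last M) v
  have hdet : tauDet c (M + 1) = B.det := by
    have h := Matrix.det_updateRow_sum A (Fin.last M) fun k => schurInv (M - k)
    simp only [Fin.val_last, Nat.sub_self, schurInv_zero, one_smul] at h
    exact h.symm
  have hminor : tauDet c M = (B.submatrix Fin.castSucc Fin.castSucc).det := by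
    rw [tauDet]
    congr 1
    ext1 i k
    exact (congrFun (Matrix.updateRow_ne (M := A) (b := v) (Fin.castSucc_lt_last i).ne)
      k.castSucc).symm
  have hlast : ∀ j, B (Fin.last M) j - MvPowerSeries.C (c j M) ∈ weightIdeal (M + 1) := by
    intro j
    have hsum : v j = ∑ p ∈ Finset.HasAntidiagonal.antidiagonal M,
        schurInv p.1 * expCoeff (c j) (p.2 : ℕ) := by
      rw [← Finset.Nat.sum_antidiagonal_swap, Finset.Nat.sum_antidiagonal_eq_sum_range_succ_mk,
        Finset.sum_range]
      simp only [v, Finset.sum_apply, Pi.smul_apply, smul_eq_mul]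
      rfl
    have hB : B (Fin.last M) j = v j := congrFun (Matrix.updateRow_self (M := A)) j
    rw [hB, hsum]
    exact sum_schurInv_mul_expCoeff (c j) M
  rw [hdet, hminor]
  refine det_sub_det_submatrix_castSucc_mem ?_ fun j => ?_
  · have h := hlast (Fin.last M)
    rwa [Fin.val_last, hc.eq_one, map_one] at h
  · have h := hlast j.castSucc
    rwa [hc.eq_zero _ _ (by exact_mod_cast j.2), map_zero, sub_zero] at h

theorem coeff_tauDet {c : ℕ → ℤ → ℂ} (hc : IsUnitriangular c) {d : ℕ+ →₀ ℕ} {M : ℕ}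
    (h : wt d ≤ M) :
    MvPowerSeries.coeff d (tauDet c M) = MvPowerSeries.coeff d (tauDet c (wt d)) := by
  induction M, h using Nat.le_induction with
  | base => rfl
  | succ M h ih =>
    rw [← ih, ← sub_eq_zero, ← map_sub]
    exact tauDet_succ_sub_mem hc M d (Nat.lt_succ_of_le h)

/-- The stable limit of the determinants `tauDet c M`. -/
def tauLimit (c : ℕ → ℤ → ℂ) : R := fun d => MvPowerSeries.coeff d (tauDet c (wt d))

theorem isStableLimit_tauDet {c : ℕ → ℤ → ℂ} (hc : IsUnitriangular c) :
    IsStableLimit (tauDet c) (tauLimit c) :=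
  fun _ => ⟨_, fun _ hN _ hd => coeff_tauDet hc (hd.trans hN)⟩

theorem constantCoeff_tauLimit (c : ℕ → ℤ → ℂ) :
    MvPowerSeries.constantCoeff (tauLimit c) = 1 := by
  rw [← MvPowerSeries.coeff_zero_eq_constantCoeff_apply]
  change MvPowerSeries.coeff 0 (tauDet c (wt 0)) = 1
  rw [wt_zero, tauDet, Matrix.det_isEmpty, MvPowerSeries.coeff_zero_one]

theorem constantCoeff_tauDet {c : ℕ → ℤ → ℂ} (hc : IsUnitriangular c) (M : ℕ) :
    MvPowerSeries.constantCoeff (tauDet c M) = 1 := by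
  rw [← MvPowerSeries.coeff_zero_eq_constantCoeff_apply, coeff_tauDet hc (Nat.zero_le M), wt_zero,
    tauDet, Matrix.det_isEmpty, MvPowerSeries.coeff_zero_one]

theorem tauDet_ne_zero {c : ℕ → ℤ → ℂ} (hc : IsUnitriangular c) (M : ℕ) : tauDet c M ≠ 0 :=
  ne_zero_of_map (f := MvPowerSeries.constantCoeff)
    (by rw [constantCoeff_tauDet hc]; exact one_ne_zero)

/-! ### The truncated operators -/

/-- The cofactors of a row put on top of the rows of `B`. -/
def topCofactor {A : Type*} [CommRing A] {M : ℕ} (B : Fin M → Fin (M + 1) → A)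
    (j : Fin (M + 1)) : A :=
  (-1) ^ (j : ℕ) * (Matrix.of fun i k => B i (j.succAbove k)).det

theorem det_cons_eq_sum {A : Type*} [CommRing A] {M : ℕ} (B : Fin M → Fin (M + 1) → A)
    (v : Fin (M + 1) → A) :
    (Matrix.of (Fin.cons v B : Fin (M + 1) → Fin (M + 1) → A)).det =
      ∑ j, v j * topCofactor B j := by
  rw [Matrix.det_succ_row_zero]
  refine Finset.sum_congr rfl fun j _ => ?_
  rw [topCofactor, mul_comm ((-1) ^ (j : ℕ)), mul_assoc]
  rfl

theorem map_topCofactor {A A' : Type*} [CommRing A] [CommRing A'] (φ : A →+* A') {M : ℕ}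
    (B : Fin M → Fin (M + 1) → A) (j : Fin (M + 1)) :
    topCofactor (fun i k => φ (B i k)) j = φ (topCofactor B j) := by
  rw [topCofactor, topCofactor, map_mul, map_pow, map_neg, map_one, RingHom.map_det]
  rfl

/-- Put the row `(1, x, …, x ^ M)` on top of `B` and subtract from each column `x` times the
previous one. -/
theorem sum_pow_mul_topCofactor {A : Type*} [CommRing A] {M : ℕ} (B : Fin M → Fin (M + 1) → A)
    (x : A) :
    ∑ j : Fin (M + 1), x ^ (j : ℕ) * topCofactor B j =
      (Matrix.of fun i k : Fin M => B i k.succ - x * B i k.castSucc).det := by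
  set B' : Fin M → Fin (M + 1) → A := fun i => Fin.cons (B i 0) fun k =>
    B i k.succ - x * B i k.castSucc
  have column_operations :
      (Matrix.of (Fin.cons (fun j => x ^ (j : ℕ)) B : Fin (M + 1) → Fin (M + 1) → A)).det =
        (Matrix.of (Fin.cons (Pi.single 0 1) B' : Fin (M + 1) → Fin (M + 1) → A)).det := by
    refine Matrix.det_eq_of_forall_col_eq_smul_add_pred (fun _ => x) (fun i => ?_) fun i k => ?_
    · refine Fin.cases ?_ (fun i => ?_) i <;> simp [B']
    · refine Fin.cases ?_ (fun i => ?_) i <;> simp [B', pow_succ']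
  have first_column : ∀ j ≠ 0, (Pi.single 0 1 : Fin (M + 1) → A) j * topCofactor B' j = 0 :=
    fun j hj => by rw [Pi.single_eq_of_ne hj, zero_mul]
  rw [← det_cons_eq_sum, column_operations, det_cons_eq_sum,
    Finset.sum_eq_single_of_mem 0 (Finset.mem_univ _) fun j _ => first_column j,
    Pi.single_eq_same, one_mul, topCofactor, Fin.val_zero, pow_zero, one_mul]
  rfl

/-- The rows `(D ^ M f_i, …, D f_i, f_i)` for `f_i = ∮ z ^ (-M) exp ξ ω_i dz`, where
`ω_i = ∑ c_{i,l} z ^ l`. -/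
def wronskianRows (c : ℕ → ℤ → ℂ) (M : ℕ) (i : Fin M) (j : Fin (M + 1)) : R :=
  expCoeff (c i) ((j : ℕ) - 1)

theorem miwaHom_tauDet (c : ℕ → ℤ → ℂ) (M : ℕ) :
    miwaHom (tauDet c M) = ∑ j : Fin (M + 1),
      PowerSeries.X ^ (j : ℕ) * PowerSeries.C (topCofactor (wronskianRows c M) j) := by
  simp only [← map_topCofactor]
  rw [sum_pow_mul_topCofactor, tauDet, RingHom.map_det, ← Matrix.det_transpose]
  congr 1
  ext1 i k
  rw [Matrix.transpose_apply, RingHom.mapMatrix_apply, Matrix.map_apply, Matrix.of_apply,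
    Matrix.of_apply, miwaHom_of_pd (pd_expCoeff _)]
  simp only [wronskianRows, Fin.val_succ, Fin.val_castSucc, Nat.cast_succ, add_sub_cancel_right]

theorem miwa_tauDet (c : ℕ → ℤ → ℂ) (M m : ℕ) :
    miwa (tauDet c M) m =
      ∑ j : Fin (M + 1), (if m = j then 1 else 0) * topCofactor (wronskianRows c M) j := by
  rw [← coeff_miwaHom, miwaHom_tauDet, map_sum]
  refine Finset.sum_congr rfl fun j _ => ?_
  rw [PowerSeries.coeff_mul_C, PowerSeries.coeff_X_pow]

/-- The operator with symbol `τ(t - [z⁻¹]) / τ(t)`. -/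
def dressing (τ : R) : PDO := ⟨(waveOfTau τ).coeff, (waveOfTau τ).bdd⟩

theorem coeff_dressing (τ : R) (k : ℤ) :
    (dressing τ).coeff k = if k ≤ 0 then miwa τ (-k).toNat * τ⁻¹ else 0 := rfl

theorem isMonic_dressing {τ : R} (hτ : MvPowerSeries.constantCoeff τ ≠ 0) :
    (dressing τ).IsMonic 0 := by
  refine ⟨?_, fun k hk => if_neg (by omega)⟩
  rw [coeff_dressing, if_pos le_rfl, neg_zero, Int.toNat_zero, miwa_zero,
    MvPowerSeries.mul_inv_cancel _ hτ]

theorem act_dressing_expXi (τ : R) : Wave.act (dressing τ) Wave.expXi = waveOfTau τ := by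
  ext1
  funext k
  rw [coeff_act_expXi]
  rfl

theorem IsStableLimit.dressing {f : ℕ → R} {F : R} (hf : IsStableLimit f F)
    (hf0 : ∀ N, MvPowerSeries.constantCoeff (f N) ≠ 0)
    (hF0 : MvPowerSeries.constantCoeff F ≠ 0) :
    PDO.IsStableLimit (fun N => GelfandDickey.dressing (f N)) (GelfandDickey.dressing F) := by
  intro k
  simp only [coeff_dressing]
  split_ifs
  · exact (hf.miwa _).mul (hf.inv hf0 hF0)
  · exact IsStableLimit.const 0

/-- The Fourier coefficients of the `ω_m`. -/
def omegaCoeff {n : ℕ} [NeZero n] (w : Fin n → H n) (m : ℕ) (l : ℤ) : ℂ :=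
  fourierCoeff (omega w m) l

theorem fourierCoeff_fourier_mul (k l : ℤ) (g : UnitAddCircle → ℂ) :
    fourierCoeff (fun θ => fourier k θ * g θ) l = fourierCoeff g (l - k) := by
  simp only [fourierCoeff, smul_eq_mul, ← mul_assoc, ← fourier_add, neg_sub, neg_add_eq_sub]

theorem moment_eq_expCoeff (i : ℕ) (g : UnitAddCircle → ℂ) :
    moment i g = expCoeff (fourierCoeff g) (i - 1) := by
  ext d
  change fourierCoeff (fun θ => expXiCoeff d θ * g θ) ((i : ℤ) - 1) = _
  simp only [expXiCoeff, mul_assoc]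
  rw [fourierCoeff.const_mul, fourierCoeff_fourier_mul]
  rfl

section Truncated

variable {n : ℕ} [NeZero n] (w : Fin n → H n) (N : ℕ)

theorem omegaCoeff_add (m : ℕ) (l : ℤ) : omegaCoeff w (m + n) (l + n) = omegaCoeff w m l := by
  have omega_add : omega w (m + n) = fun θ => fourier (n : ℤ) θ * omega w m θ := by
    funext θ
    have hfin : Fin.ofNat n (m + n) = Fin.ofNat n m := Fin.ext (Nat.add_mod_right m n)
    rw [omega, omega, hfin, Nat.add_div_right _ (NeZero.pos n), ← mul_assoc, ← fourier_add,
      Nat.mul_succ, Nat.cast_add, add_comm]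
  rw [omegaCoeff, omega_add, fourierCoeff_fourier_mul, add_sub_cancel_right]
  rfl

theorem tauN_eq : tauN w N = tauDet (omegaCoeff w) (n * N) := by
  simp only [tauN, tauDet, moment_eq_expCoeff, Nat.cast_succ, add_sub_cancel_right]
  rfl

theorem fN_eq (s : Fin (n * N)) :
    fN w N s = expCoeff (omegaCoeff w s) ((n * N : ℕ) - 1) := moment_eq_expCoeff _ _

theorem fN_eq_fN_succ (s : Fin (n * N)) :
    fN w N s = fN w (N + 1) ⟨s + n, by rw [mul_add]; omega⟩ := by
  rw [fN_eq, fN_eq]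
  ext d
  rw [coeff_expCoeff, coeff_expCoeff, ← omegaCoeff_add]
  congr 2
  push_cast
  ring

theorem D_iterate_fN (s : Fin (n * N)) (j : Fin (n * N + 1)) :
    D^[n * N - j] (fN w N s) = wronskianRows (omegaCoeff w) (n * N) s j := by
  rw [fN_eq, D_iterate_expCoeff, wronskianRows]
  congr 1
  omega

theorem wronskian_fN : wronskian (fN w N) = tauDet (omegaCoeff w) (n * N) := by
  rw [wronskian, tauDet, ← Matrix.det_transpose]
  congr 1
  ext1 i j
  rw [Matrix.transpose_apply, Matrix.of_apply, Matrix.of_apply, fN_eq, D_iterate_expCoeff]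
  congr 1
  omega

theorem coeff_DeltaN (k : ℤ) :
    (DeltaN w N).coeff k = (∑ j : Fin (n * N + 1), (if k = (n * N : ℕ) - (j : ℤ) then 1 else 0) *
      topCofactor (wronskianRows (omegaCoeff w) (n * N)) j) *
        (tauDet (omegaCoeff w) (n * N))⁻¹ := by
  rw [← det_cons_eq_sum, ← wronskian_fN]
  simp only [DeltaN, D_iterate_fN]

theorem coeff_DeltaN_sub (j : Fin (n * N + 1)) :
    (DeltaN w N).coeff ((n * N - j : ℕ) : ℤ) =
      topCofactor (wronskianRows (omegaCoeff w) (n * N)) j *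
        (tauDet (omegaCoeff w) (n * N))⁻¹ := by
  rw [coeff_DeltaN, Finset.sum_eq_single_of_mem j (Finset.mem_univ _) fun i _ hij => ?_,
    if_pos (by omega), one_mul]
  rw [if_neg fun h => hij (Fin.ext (by omega)), zero_mul]

theorem isDiff_DeltaN : (DeltaN w N).IsDiff := by
  intro k hk
  rw [coeff_DeltaN, Finset.sum_eq_zero fun j _ => ?_, zero_mul]
  rw [if_neg (by omega), zero_mul]

theorem SN_eq_dressing : SN w N = dressing (tauN w N) := by
  ext1
  funext k
  rw [SN, PDO.coeff_mul_Dpow, coeff_DeltaN, coeff_dressing, tauN_eq]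
  split_ifs with hk
  · rw [miwa_tauDet]
    congr 1
    refine Finset.sum_congr rfl fun j _ => ?_
    congr 2
    exact propext ⟨fun h => by omega, fun h => by omega⟩
  · rw [Finset.sum_eq_zero fun j _ => ?_, zero_mul]
    rw [if_neg (by omega), zero_mul]

theorem SN_mul_Dpow : SN w N * PDO.Dpow (n * N : ℕ) = DeltaN w N := by
  rw [SN, mul_assoc, PDO.Dpow_mul_Dpow, neg_add_cancel, PDO.Dpow_zero, mul_one]

variable {w} (hw : IsUnitriangular (omegaCoeff w))
include hw

theorem constantCoeff_tauN : MvPowerSeries.constantCoeff (tauN w N) = 1 := by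
  rw [tauN_eq, constantCoeff_tauDet hw]

theorem isMonic_SN : (SN w N).IsMonic 0 := by
  rw [SN_eq_dressing]
  exact isMonic_dressing (by rw [constantCoeff_tauN N hw]; exact one_ne_zero)

theorem isMonic_DeltaN : (DeltaN w N).IsMonic (n * N : ℕ) := by
  simpa only [SN_mul_Dpow, zero_add] using (isMonic_SN N hw).mul (PDO.isMonic_Dpow (n * N : ℕ))

theorem app_DeltaN_fN (s : Fin (n * N)) : PDO.app (DeltaN w N) (fN w N s) = 0 := by
  have horder : OrderLE (DeltaN w N).coeff ((n * N + 1 : ℕ) - 1) :=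
    (isMonic_DeltaN N hw).orderLE.mono (by push_cast; omega)
  have repeated_row : (Matrix.of (Fin.cons (wronskianRows (omegaCoeff w) (n * N) s)
      (wronskianRows (omegaCoeff w) (n * N)) : Fin (n * N + 1) → Fin (n * N + 1) → R)).det = 0 :=
    Matrix.det_zero_of_row_eq (Fin.succ_ne_zero s).symm rfl
  rw [PDO.app_eq_sum horder, ← Finset.sum_range_reflect, Finset.sum_range,
    ← zero_mul (tauDet (omegaCoeff w) (n * N))⁻¹, ← repeated_row, det_cons_eq_sum, Finset.sum_mul]
  refine Finset.sum_congr rfl fun j _ => ?_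
  rw [Nat.add_sub_cancel, coeff_DeltaN_sub, D_iterate_fN]
  ring

theorem exists_eq_mul_DeltaN {P : PDO} (hP : P.IsDiff) (hPf : ∀ s, PDO.app P (fN w N s) = 0) :
    ∃ B : PDO, B.IsDiff ∧ P = B * DeltaN w N :=
  PDO.exists_eq_mul_of_app_eq_zero (isDiff_DeltaN w N) (isMonic_DeltaN N hw)
    (by rw [wronskian_fN]; exact tauDet_ne_zero hw _) (app_DeltaN_fN N hw) hP hPf

/-- Differentiating `Δ f_s = 0` and using `∂f_s/∂t_j = D ^ j f_s`, one sees that `∂Δ/∂t_j + Δ D ^ j`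
annihilates the `f_s`. -/
theorem isDressing_SN : (SN w N).IsDressing := by
  refine ⟨isMonic_SN N hw, fun j => ?_⟩
  have hΔ := isDiff_DeltaN w N
  obtain ⟨B, hB, hBΔ⟩ := exists_eq_mul_DeltaN N hw
    (P := (DeltaN w N).tderiv j + DeltaN w N * PDO.Dpow (j : ℕ))
    ((hΔ.tderiv j).add (hΔ.mul (PDO.isDiff_Dpow _))) fun s => by
      rw [PDO.app_add, PDO.app_mul hΔ (PDO.isDiff_Dpow _), PDO.app_Dpow, fN_eq,
        D_iterate_expCoeff, ← pd_expCoeff, ← PDO.pd_app, ← fN_eq, app_DeltaN_fN N hw]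
      exact map_zero _
  refine ⟨B, hB, ?_⟩
  calc (SN w N).tderiv j + SN w N * PDO.Dpow (j : ℕ)
      = ((DeltaN w N).tderiv j + DeltaN w N * PDO.Dpow (j : ℕ)) * PDO.Dpow (-(n * N : ℕ)) := by
        rw [SN, PDO.tderiv_mul, PDO.tderiv_Dpow, mul_zero, add_zero, add_mul, mul_assoc, mul_assoc,
          PDO.Dpow_mul_Dpow, PDO.Dpow_mul_Dpow, add_comm (j : ℤ)]
    _ = B * SN w N := by rw [hBΔ, mul_assoc, SN]

theorem exists_SN_succ : ∃ B : PDO, B.IsDiff ∧ SN w (N + 1) * PDO.Dpow n = B * SN w N := by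
  obtain ⟨B, hB, hBΔ⟩ := exists_eq_mul_DeltaN N hw (isDiff_DeltaN w (N + 1)) fun s => by
    rw [fN_eq_fN_succ, app_DeltaN_fN _ hw]
  refine ⟨B, hB, ?_⟩
  rw [SN, SN, ← mul_assoc, ← hBΔ, mul_assoc, PDO.Dpow_mul_Dpow]
  congr 2
  push_cast
  ring

end Truncated

section Limit

variable {n : ℕ} [NeZero n] {w : Fin n → H n}

theorem isStableLimit_tauN (hw : IsUnitriangular (omegaCoeff w)) :
    IsStableLimit (tauN w) (tauLimit (omegaCoeff w)) := by
  simp only [funext (tauN_eq w)]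
  exact (isStableLimit_tauDet hw).comp_tendsto
    (tendsto_id.const_mul_atTop' (NeZero.pos n) : Tendsto (fun N => n * N) atTop atTop)

theorem isStableLimit_SN (hw : IsUnitriangular (omegaCoeff w)) :
    PDO.IsStableLimit (SN w) (dressing (tauLimit (omegaCoeff w))) := by
  simp only [funext (SN_eq_dressing w)]
  refine (isStableLimit_tauN hw).dressing (fun N => ?_) ?_
  · rw [constantCoeff_tauN N hw]; exact one_ne_zero
  · rw [constantCoeff_tauLimit]; exact one_ne_zero

end Limit

/-! ### Fourier coefficients -/

section FourierCoefficients

section CompNsmul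

variable {T : ℝ} [hT : Fact (0 < T)] {E : Type*} [NormedAddCommGroup E] [NormedSpace ℂ E] {n : ℕ}

theorem measurePreserving_nsmul_haarAddCircle (hn : n ≠ 0) :
    MeasurePreserving (fun θ : AddCircle T => n • θ) haarAddCircle haarAddCircle := by
  simpa only [natCast_zsmul] using Measure.measurePreserving_zsmul
    (haarAddCircle : Measure (AddCircle T)) (n := (n : ℤ)) (by exact_mod_cast hn)

theorem fourierCoeff_comp_nsmul (hn : n ≠ 0) {g : AddCircle T → E}
    (hg : Integrable g haarAddCircle) (q : ℤ) :
    fourierCoeff (fun θ => g (n • θ)) (n * q) = fourierCoeff g q := by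
  have hmp := measurePreserving_nsmul_haarAddCircle (T := T) hn
  have change_of_variable := integral_map (f := fun θ => fourier (-q) θ • g θ)
    hmp.measurable.aemeasurable (hmp.map_eq.symm ▸ (hg.fourier_smul (-q)).aestronglyMeasurable)
  rw [hmp.map_eq] at change_of_variable
  refine Eq.trans ?_ change_of_variable.symm
  simp only [fourierCoeff, fourier_apply, show -(n * q) = -q * n by ring, mul_smul, natCast_zsmul]

/-- The integrand is multiplied by a factor other than `1` under translation by `T / n`. -/
theorem fourierCoeff_comp_nsmul_of_not_dvd (hn : n ≠ 0) (g : AddCircle T → E) {l : ℤ}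
    (hl : ¬(n : ℤ) ∣ l) : fourierCoeff (fun θ => g (n • θ)) l = 0 := by
  set u : AddCircle T := ((T / n : ℝ) : AddCircle T)
  have order_u : addOrderOf u = n := addOrderOf_period_div (Nat.pos_of_ne_zero hn)
  have nsmul_u : n • u = 0 := addOrderOf_dvd_iff_nsmul_eq_zero.1 order_u.dvd
  have fourier_u : fourier (-l) u ≠ 1 := by
    intro h
    rw [fourier_apply, Circle.coe_eq_one, ← toCircle_zero (T := T)] at h
    rw [← dvd_neg, ← order_u, addOrderOf_dvd_iff_zsmul_eq_zero] at hl
    exact hl (injective_toCircle hT.out.ne' h)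
  have translate : ∀ θ, fourier (-l) (θ + u) • g (n • (θ + u)) =
      fourier (-l) u • (fourier (-l) θ • g (n • θ)) := fun θ => by
    rw [nsmul_add, nsmul_u, add_zero, fourier_apply, smul_add, toCircle_add, Circle.coe_mul,
      mul_comm, mul_smul, fourier_apply, fourier_apply]
  have invariance : fourier (-l) u • fourierCoeff (fun θ => g (n • θ)) l =
      fourierCoeff (fun θ => g (n • θ)) l := by
    rw [fourierCoeff, ← integral_smul]
    simp only [← translate]
    exact integral_add_right_eq_self (fun θ => fourier (-l) θ • g (n • θ)) u
  have sub_one_smul : (fourier (-l) u - 1) • fourierCoeff (fun θ => g (n • θ)) l = 0 := by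
    rw [sub_smul, one_smul, invariance, sub_self]
  exact (smul_eq_zero.1 sub_one_smul).resolve_left (sub_ne_zero.2 fourier_u)

end CompNsmul

variable {n : ℕ}

theorem integrable_H (f : H n) : Integrable (f : UnitAddCircle → _) haarAddCircle :=
  (Lp.memLp f).integrable one_le_two

theorem integrable_H_apply (f : H n) (i : Fin n) :
    Integrable (fun θ => f θ i) haarAddCircle :=
  (EuclideanSpace.proj i : EuclideanSpace ℂ (Fin n) →L[ℂ] ℂ).integrable_comp (integrable_H f)

theorem fourierCoeff_apply (f : H n) (k : ℤ) (i : Fin n) :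
    fourierCoeff (f : UnitAddCircle → _) k i = fourierCoeff (fun θ => f θ i) k :=
  (ContinuousLinearMap.integral_comp_comm
    (EuclideanSpace.proj i : EuclideanSpace ℂ (Fin n) →L[ℂ] ℂ)
    ((integrable_H f).fourier_smul (-k))).symm

theorem coeFn_e (α : Fin n) (k : ℤ) : (e n α k : UnitAddCircle → _) =ᵐ[haarAddCircle]
    fun θ => fourier k θ • EuclideanSpace.single α (1 : ℂ) :=
  ContinuousMap.coeFn_toLp haarAddCircle _

theorem inner_e (f : H n) (α : Fin n) (k : ℤ) :
    inner ℂ (e n α k) f = fourierCoeff (f : UnitAddCircle → _) k α := by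
  rw [fourierCoeff_apply, L2.inner_def, fourierCoeff]
  refine integral_congr_ae ?_
  filter_upwards [coeFn_e α k] with θ hθ
  rw [hθ, inner_smul_left, EuclideanSpace.inner_single_left, map_one, one_mul, smul_eq_mul,
    fourier_neg]

theorem fourierCoeff_e (α β : Fin n) (k l : ℤ) :
    fourierCoeff (e n α k : UnitAddCircle → _) l β = if α = β ∧ k = l then 1 else 0 := by
  have component : (fun θ => (e n α k : UnitAddCircle → _) θ β) =ᵐ[haarAddCircle]
      fun θ => (if α = β then 1 else 0) * fourier k θ := by
    filter_upwards [coeFn_e α k] with θ hθ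
    rw [hθ, PiLp.smul_apply, PiLp.single_apply, smul_eq_mul, mul_comm]
    simp only [eq_comm]
  rw [fourierCoeff_apply, fourierCoeff_congr_ae component, fourierCoeff.const_mul,
    fourierCoeff_fourier, Pi.single_apply, ite_and, ite_mul, one_mul, zero_mul]
  simp only [eq_comm]

theorem fourierCoeff_Xi_eq_sum (f : H n) (l : ℤ) : fourierCoeff (Xi f) l =
    ∑ i : Fin n, fourierCoeff (fun θ : UnitAddCircle => f (n • θ) i) (l - i) := by
  have integrable_comp : ∀ i : Fin n,
      Integrable (fun θ : UnitAddCircle => f (n • θ) i) haarAddCircle := fun i =>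
    (measurePreserving_nsmul_haarAddCircle i.pos.ne').integrable_comp_of_integrable
      (g := fun θ => f θ i) (integrable_H_apply f i)
  have hXi : Xi f = ∑ i : Fin n, fun θ => fourier (i : ℤ) θ * f (n • θ) i := by
    funext θ
    rw [Finset.sum_apply, Xi]
  rw [hXi, fourierCoeff.sum Finset.univ (fun (i : Fin n) (θ : UnitAddCircle) =>
    fourier (i : ℤ) θ * f (n • θ) i) fun i _ => (integrable_comp i).fourier_smul (i : ℤ),
    Finset.sum_apply]
  exact Finset.sum_congr rfl fun i _ => fourierCoeff_fourier_mul (i : ℤ) l _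

theorem fourierCoeff_Xi (f : H n) (q : ℤ) (i : Fin n) :
    fourierCoeff (Xi f) (n * q + i) = fourierCoeff (f : UnitAddCircle → _) q i := by
  have hn : n ≠ 0 := i.pos.ne'
  have not_dvd : ∀ j ≠ i, ¬(n : ℤ) ∣ n * q + i - j := fun j hj h => hj <| by
    have hmod : (j : ℤ) ≡ i [ZMOD n] := Int.modEq_iff_dvd.2 <| by
      simpa only [add_sub_assoc, dvd_add_right (dvd_mul_right (n : ℤ) q)] using h
    exact Fin.ext (Nat.ModEq.eq_of_lt_of_lt (Int.natCast_modEq_iff.1 hmod) j.2 i.2)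
  rw [fourierCoeff_Xi_eq_sum, Finset.sum_eq_single_of_mem i (Finset.mem_univ _) fun j _ hj =>
    fourierCoeff_comp_nsmul_of_not_dvd hn (fun θ => f θ j) (not_dvd j hj), add_sub_cancel_right,
    fourierCoeff_comp_nsmul hn (integrable_H_apply f i), fourierCoeff_apply]

theorem omegaCoeff_mul_add [NeZero n] (w : Fin n → H n) (s : ℕ) (j i : Fin n) (q : ℤ) :
    omegaCoeff w (n * s + j) (n * q + i) =
      fourierCoeff (w j : UnitAddCircle → _) (q - s) i := by
  have hdiv : (n * s + j : ℕ) / n = s := by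
    rw [Nat.mul_add_div (NeZero.pos n), Nat.div_eq_of_lt j.2, add_zero]
  have hmod : Fin.ofNat n (n * s + j) = j :=
    Fin.ext ((Nat.mul_add_mod _ _ _).trans (Nat.mod_eq_of_lt j.2))
  rw [← fourierCoeff_Xi, show (n * (q - s) + i : ℤ) = n * q + i - (n * s : ℕ) by push_cast; ring,
    ← fourierCoeff_fourier_mul, omegaCoeff]
  congr 1
  funext θ
  rw [omega, hdiv, hmod]

end FourierCoefficients

/-! ### Normalized frames -/

section Frames

variable {n : ℕ} {W : Submodule ℂ (H n)}

/-- The normalized frame whose matrix is `1` plus a series in strictly negative powers of `z`: the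
preimages of `e_{1,0}, …, e_{n,0}` under `pr₊`. -/
structure IsCanonicalFrame (W : Submodule ℂ (H n)) (w : Fin n → H n) : Prop where
  mem : ∀ j, w j ∈ W
  fourierCoeff_eq : ∀ j i, ∀ k : ℤ, 0 ≤ k →
    fourierCoeff (w j : UnitAddCircle → _) k i = if j = i ∧ 0 = k then 1 else 0

theorem e_mem_Hplus (α : Fin n) {k : ℤ} (hk : 0 ≤ k) : e n α k ∈ Hplus n :=
  Submodule.le_topologicalClosure _ (Submodule.subset_span ⟨α, k, hk, rfl⟩)

theorem prPlus_eq_zero {f : W}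
    (h : ∀ (α : Fin n) (k : ℤ), 0 ≤ k → fourierCoeff ((f : H n) : UnitAddCircle → _) k α = 0) :
    prPlus W f = 0 := by
  change (Hplus n).orthogonalProjectionOnto (f : H n) = 0
  rw [Submodule.orthogonalProjectionOnto_eq_zero_iff, Hplus, Submodule.orthogonal_closure,
    Submodule.mem_orthogonal]
  intro u hu
  induction hu using Submodule.span_induction with
  | mem x hx =>
    obtain ⟨α, k, hk, rfl⟩ := hx
    rw [inner_e, h α k hk]
  | zero => exact inner_zero_left _
  | add x y _ _ hx hy => rw [inner_add_left, hx, hy, add_zero]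
  | smul a x _ hx => rw [inner_smul_left, hx, mul_zero]

theorem InBigCell.eq_zero_of_fourierCoeff (hcell : InBigCell W) {f : H n} (hf : f ∈ W)
    (h : ∀ (α : Fin n) (k : ℤ), 0 ≤ k → fourierCoeff (f : UnitAddCircle → _) k α = 0) :
    f = 0 :=
  congrArg Subtype.val <| hcell.1 <|
    (prPlus_eq_zero (f := ⟨f, hf⟩) h).trans (map_zero (prPlus W)).symm

theorem InBigCell.exists_isCanonicalFrame (hcell : InBigCell W) :
    ∃ w : Fin n → H n, IsCanonicalFrame W w := by
  choose w hw using fun j : Fin n => hcell.2 ⟨e n j 0, e_mem_Hplus j le_rfl⟩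
  refine ⟨fun j => w j, fun j => (w j).2, fun j i k hk => ?_⟩
  have inner_eq := Submodule.inner_orthogonalProjectionOnto_eq_of_mem_left
    (K := Hplus n) ⟨e n i k, e_mem_Hplus i hk⟩ (w j : H n)
  have projection_eq : (Hplus n).orthogonalProjectionOnto (w j : H n) =
      ⟨e n j 0, e_mem_Hplus j le_rfl⟩ := hw j
  rw [← inner_e, ← inner_eq, projection_eq, ← fourierCoeff_e, ← inner_e]
  rfl

theorem IsCanonicalFrame.isNormalizedFrame {w : Fin n → H n} (hw : IsCanonicalFrame W w) :
    IsNormalizedFrame W w where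
  mem := hw.mem
  pos j i k hk := by rw [hw.fourierCoeff_eq j i k hk.le, if_neg (by omega)]
  diag j := by rw [hw.fourierCoeff_eq j j 0 le_rfl, if_pos ⟨rfl, rfl⟩]
  lower j i hij := by rw [hw.fourierCoeff_eq j i 0 le_rfl, if_neg fun h => hij.ne h.1]

theorem IsCanonicalFrame.eq_sum {w₀ w : Fin n → H n} (hw₀ : IsCanonicalFrame W w₀)
    (hcell : InBigCell W) (hw : IsNormalizedFrame W w) (j : Fin n) :
    w j = ∑ i, fourierCoeff (w j : UnitAddCircle → _) 0 i • w₀ i := by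
  rw [← sub_eq_zero]
  refine hcell.eq_zero_of_fourierCoeff
    (sub_mem (hw.mem j) (sum_mem fun i _ => Submodule.smul_mem _ _ (hw₀.mem i))) fun α k hk => ?_
  rw [← inner_e, inner_sub_right, inner_sum]
  simp only [inner_smul_right, inner_e, hw₀.fourierCoeff_eq _ _ _ hk]
  rcases hk.eq_or_lt with rfl | hk
  · simp only [and_true, mul_ite, mul_one, mul_zero, Finset.sum_ite_eq', Finset.mem_univ, if_true,
      sub_self]
  · rw [hw.pos j α k hk, Finset.sum_eq_zero fun i _ => by rw [if_neg (by omega), mul_zero],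
      sub_zero]

variable [NeZero n]

theorem exists_eq_mul_add_fin (l : ℤ) : ∃ (q : ℤ) (i : Fin n), l = n * q + i := by
  have hn : (0 : ℤ) < n := by exact_mod_cast NeZero.pos n
  have hnonneg := Int.emod_nonneg l hn.ne'
  have hlt := Int.emod_lt_of_pos l hn
  refine ⟨l / n, ⟨(l % n).toNat, by omega⟩, ?_⟩
  rw [Int.toNat_of_nonneg hnonneg, Int.mul_ediv_add_emod]

theorem IsNormalizedFrame.isUnitriangular {w : Fin n → H n} (hw : IsNormalizedFrame W w) :
    IsUnitriangular (omegaCoeff w) := by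
  have index_eq : ∀ m : ℕ, ∃ (s : ℕ) (j : Fin n), m = n * s + j := fun m =>
    ⟨m / n, Fin.ofNat n m, (Nat.div_add_mod m n).symm⟩
  constructor
  · intro m l hml
    obtain ⟨s, j, rfl⟩ := index_eq m
    obtain ⟨q, i, rfl⟩ := exists_eq_mul_add_fin (n := n) l
    rw [omegaCoeff_mul_add]
    push_cast at hml
    rcases lt_trichotomy (s : ℤ) q with hsq | rfl | hqs
    · exact hw.pos _ _ _ (sub_pos.2 hsq)
    · rw [sub_self]
      exact hw.lower _ _ (Fin.lt_def.2 (by omega))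
    · have hmul : (n : ℤ) * (q + 1) ≤ n * s := by gcongr; omega
      have hi := i.2
      rw [mul_add, mul_one] at hmul
      omega
  · intro m
    obtain ⟨s, j, rfl⟩ := index_eq m
    push_cast
    rw [omegaCoeff_mul_add, sub_self, hw.diag]

theorem omegaCoeff_of_eq_sum {w w₀ : Fin n → H n} {A : Matrix (Fin n) (Fin n) ℂ}
    (h : ∀ j, w j = ∑ i, A i j • w₀ i) (s : ℕ) (j : Fin n) (l : ℤ) :
    omegaCoeff w (n * s + j) l = ∑ i : Fin n, A i j * omegaCoeff w₀ (n * s + i) l := by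
  obtain ⟨q, r, rfl⟩ := exists_eq_mul_add_fin (n := n) l
  simp only [omegaCoeff_mul_add, ← inner_e, h j, inner_sum, inner_smul_right]

theorem tauN_of_eq_sum {w w₀ : Fin n → H n} {A : Matrix (Fin n) (Fin n) ℂ}
    (h : ∀ j, w j = ∑ i, A i j • w₀ i) (N : ℕ) :
    tauN w N = MvPowerSeries.C A.det ^ N * tauN w₀ N := by
  let index : Fin n × Fin N ≃ Fin (n * N) :=
    (Equiv.prodComm _ _).trans (finProdFinEquiv.trans (finCongr (mul_comm N n)))
  have index_val : ∀ p, (index p : ℕ) = n * p.2 + p.1 := fun p => add_comm _ _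
  have factorization : (Matrix.of fun i j : Fin (n * N) =>
        expCoeff (omegaCoeff w j) (i : ℕ)).submatrix index index =
      (Matrix.of fun i j : Fin (n * N) =>
        expCoeff (omegaCoeff w₀ j) (i : ℕ)).submatrix index index *
          Matrix.blockDiagonal fun _ : Fin N => A.map (MvPowerSeries.C : ℂ →+* R) := by
    ext p ⟨j, s⟩ d
    simp only [Matrix.mul_apply, Fintype.sum_prod_type, Matrix.blockDiagonal_apply, mul_ite,
      mul_zero, Finset.sum_ite_eq', Finset.mem_univ, if_true, Matrix.submatrix_apply,
      Matrix.of_apply, Matrix.map_apply, map_sum, MvPowerSeries.coeff_mul_C, coeff_expCoeff,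
      index_val, omegaCoeff_of_eq_sum h, Finset.mul_sum]
    exact Finset.sum_congr rfl fun i _ => by ring
  rw [tauN_eq, tauN_eq, tauDet, tauDet, ← Matrix.det_submatrix_equiv_self index, factorization,
    Matrix.det_mul, Matrix.det_blockDiagonal, Matrix.det_submatrix_equiv_self, Finset.prod_const,
    Finset.card_univ, Fintype.card_fin, mul_comm, RingHom.map_det, RingHom.mapMatrix_apply]

theorem IsCanonicalFrame.tauN_eq_tauN {w₀ w : Fin n → H n} (hw₀ : IsCanonicalFrame W w₀)
    (hcell : InBigCell W) (hw : IsNormalizedFrame W w) : tauN w = tauN w₀ := by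
  let A : Matrix (Fin n) (Fin n) ℂ :=
    Matrix.of fun i j => fourierCoeff (w j : UnitAddCircle → _) 0 i
  have w_eq_sum : ∀ j, w j = ∑ i, A i j • w₀ i := hw₀.eq_sum hcell hw
  have det_eq_one : A.det = 1 :=
    (Matrix.det_of_isUpperTriangular (M := A) fun i j hji => hw.lower j i hji).trans <|
      Finset.prod_eq_one fun j _ => hw.diag j
  funext N
  rw [tauN_of_eq_sum w_eq_sum, det_eq_one, map_one, one_pow, one_mul]

theorem IsCanonicalFrame.SN_eq_SN {w₀ w : Fin n → H n} (hw₀ : IsCanonicalFrame W w₀)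
    (hcell : InBigCell W) (hw : IsNormalizedFrame W w) : SN w = SN w₀ := by
  funext N
  rw [SN_eq_dressing, SN_eq_dressing, hw₀.tauN_eq_tauN hcell hw]

theorem IsCanonicalFrame.isStableLimit {w₀ w : Fin n → H n} (hw₀ : IsCanonicalFrame W w₀)
    (hcell : InBigCell W) (hw : IsNormalizedFrame W w) :
    IsStableLimit (tauN w) (tauLimit (omegaCoeff w₀)) ∧
      PDO.IsStableLimit (SN w) (dressing (tauLimit (omegaCoeff w₀))) := by
  rw [hw₀.SN_eq_SN hcell hw, hw₀.tauN_eq_tauN hcell hw]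
  have hu := hw₀.isNormalizedFrame.isUnitriangular
  exact ⟨isStableLimit_tauN hu, isStableLimit_SN hu⟩

end Frames

end

end GelfandDickey

theorem mainTheorem8_general (n : ℕ) [NeZero n] (W : Submodule ℂ (H n)) (hcell : InBigCell W) :
    (∃ w : Fin n → H n, IsNormalizedFrame W w) ∧
    ∃ (τ : R) (S : PDO) (ψ : Wave) (𝓛 : PDO),
      (∀ w : Fin n → H n, IsNormalizedFrame W w →
        IsStableLimit (tauN w) τ ∧
        PDO.IsStableLimit (SN w) S ∧
        Wave.IsStableLimit (psiN w) ψ ∧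
        PDO.IsStableLimit (LaxN w) 𝓛 ∧
        PDO.IsStableLimit (fun N => LaxN w N ^ n) (𝓛 ^ n)) ∧
      S.IsMonic 0 ∧ S * S⁻¹ = 1 ∧ S⁻¹ * S = 1 ∧
      𝓛 = S * PDO.Dpow 1 * S⁻¹ ∧
      ψ = Wave.act S Wave.expXi ∧
      IsKPSolution 𝓛 ∧
      IsGelfandDickeySolution n (𝓛 ^ n) 𝓛 ∧
      IsWaveFunction n (𝓛 ^ n) 𝓛 ψ ∧
      IsTauFunction ψ τ := by
  obtain ⟨w₀, hw₀⟩ := hcell.exists_isCanonicalFrame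
  have hu := hw₀.isNormalizedFrame.isUnitriangular
  set τ := tauLimit (omegaCoeff w₀)
  have hτ : MvPowerSeries.constantCoeff τ ≠ 0 := by
    rw [constantCoeff_tauLimit]; exact one_ne_zero
  have hS : (dressing τ).IsDressing := (isStableLimit_SN hu).isDressing (isDressing_SN · hu)
  have hL : (PDO.lax (dressing τ) ^ n).IsDiff :=
    (isStableLimit_SN hu).isDiff_lax_pow (isMonic_SN · hu) (exists_SN_succ · hu)
  refine ⟨⟨w₀, hw₀.isNormalizedFrame⟩, τ, dressing τ, Wave.act (dressing τ) Wave.expXi,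
    PDO.lax (dressing τ), fun w hw => ?_, hS.monic, hS.monic.mul_inv_cancel,
    hS.monic.inv_mul_cancel, rfl, rfl, hS.isKPSolution, hS.isGelfandDickeySolution hL,
    hS.isWaveFunction n, hτ, act_dressing_expXi τ⟩
  obtain ⟨hτw, hSw⟩ := hw₀.isStableLimit hcell hw
  have hmonic := fun N => isMonic_SN N hw.isUnitriangular
  exact ⟨hτw, hSw, hSw.act_expXi, hSw.lax hmonic,
    (hSw.lax hmonic).pow (fun N => (hmonic N).isMonic_lax) n⟩

theorem mainTheorem8 (n : ℕ) [NeZero n] (W : Submodule ℂ (H n)) (hW : IsGr W)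
    (hcell : InBigCell W) :
    (∃ w : Fin n → H n, IsNormalizedFrame W w) ∧
    ∃ (τ : R) (S : PDO) (ψ : Wave) (𝓛 : PDO),
      (∀ w : Fin n → H n, IsNormalizedFrame W w →
        IsStableLimit (tauN w) τ ∧
        PDO.IsStableLimit (SN w) S ∧
        Wave.IsStableLimit (psiN w) ψ ∧
        PDO.IsStableLimit (LaxN w) 𝓛 ∧
        PDO.IsStableLimit (fun N => LaxN w N ^ n) (𝓛 ^ n)) ∧
      S.IsMonic 0 ∧ S * S⁻¹ = 1 ∧ S⁻¹ * S = 1 ∧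
      𝓛 = S * PDO.Dpow 1 * S⁻¹ ∧
      ψ = Wave.act S Wave.expXi ∧
      IsKPSolution 𝓛 ∧
      IsGelfandDickeySolution n (𝓛 ^ n) 𝓛 ∧
      IsWaveFunction n (𝓛 ^ n) 𝓛 ψ ∧
      IsTauFunction ψ τ :=
  mainTheorem8_general n W hcell
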